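/- Throughout, $\mathbb{N}$ denotes the set of positive integers and $\mathbb{N}_0$ the set of non-negative integers. A domain $R$ is *Prüfer* if each localization $R_{\mathfrak m}$ at a maximal ideal $\mathfrak m$ is a valuation domain. It is *effectively given* if it comes with a listing $a_0=0,a_1=1,a_2,\dots$ of all its elements (possibly with repetitions) for which there are algorithms deciding, given $m,n\in\mathbb{N}_0$, whether $a_m=a_n$ and whether $a_m$ divides $a_n$, and producing indices of $a_m+a_n$ and $a_ma_n$. Elements of $R$ are given to algorithms through their indices, and recursiveness refers to this listing. Let $\mathrm{PP}^\star(R)$ be the set of all tuples $(p,n,c_1,\dots,c_l,d)$, with $l\ge 1$, $p$ prime, $n\in\mathbb{N}$ and $c_1,\dots,c_l,d\in R$, such that there are $s\ge 1$, $k_1,\dots,k_s\in\mathbb{N}$ and maximal ideals $\mathfrak m_1,\dots,\mathfrak m_s$ of $R$ for which $n$ is a linear combination of $k_1,\dots,k_s$ with coefficients in $\mathbb{N}_0$ and, for all $i$, $|R/\mathfrak m_i|=p^{k_i}$, $c_1,\dots,c_l\in\mathfrak m_i$ and $d\notin\mathfrak m_i$. For a pair $\phi/\psi$ of positive primitive formulae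 in one variable and an $R$-module $M$, $|\phi/\psi(M)|$ denotes the index of $\phi(M)\cap\psi(M)$ in $\phi(M)$ (a positive integer or $\infty$); $M$ satisfies $|\phi/\psi|=h$ (respectively $|\phi/\psi|\ge h$) if $|\phi/\psi(M)|=h$ (respectively $\geq h$). Call a pair *admissible* if it is of the form $xb=0\,/\,c\mid x$ or $x=x\,/\,xd=0$ with $b,c,d\in R$. For $\gamma\in R\setminus\{0\}$ let $S_\gamma$ be the class of $R$-modules $\bigoplus_{i=1}^m R_{\mathfrak m_i}/\gamma\mathfrak m_iR_{\mathfrak m_i}$ with $m\ge1$ and $\mathfrak m_1,\dots,\mathfrak m_m$ maximal ideals of $R$. For $\beta,\eta\in R\setminus\{0\}$ let $T_{\beta,\eta}$ (respectively $S'_{\beta,\eta}$) be the class of $R$-modules $\bigoplus_{i=1}^m R/\mathfrak m_i$ (respectively $\bigoplus_{i=1}^m \mathfrak m_iR_{\mathfrak m_i}/\beta\eta R_{\mathfrak m_i}$) with $m\ge 1$ and $\mathfrak m_1,\dots,\mathfrak m_m$ maximal ideals of $R$ containing both $\beta$ and $\eta$. **Proposition.** Let $R$ be an effectively given Prüfer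 domain such that each localization of $R$ at a maximal ideal has dense value group, and suppose that $\mathrm{PP}^\star(R)$ is recursive. (a) Fix $\gamma\in R\setminus\{0\}$. There is an algorithm which, given a prime $p$, numbers $t,s,u\in\mathbb{N}_0$, admissible pairs $\phi_i/\psi_i$ ($1\le i\le t+s$) and $\phi_{2,j}/\psi_{2,j}$ ($1\le j\le u$), and positive integers $w$, $n_i$ ($1\le i\le t$) and $l_i$ ($t+1\le i\le t+s$), answers whether there exists a module in $S_\gamma$ satisfying $|x=x\,/\,x\gamma=0|=p^w$ and $$\bigwedge_{i=1}^{t}|\phi_i/\psi_i|=p^{n_i}\ \wedge\ \bigwedge_{j=1}^u|\phi_{2,j}/\psi_{2,j}|=1\ \wedge\ \bigwedge_{i=t+1}^{t+s}|\phi_i/\psi_i|\ge p^{l_i}.\qquad(*)$$ (b) Fix $\beta,\eta\in R\setminus\{0\}$. There is an algorithm which, given the same data as in (a), answers whether there exists a module in $T_{\beta,\eta}$ satisfying $|x\eta=0\,/\,\beta\mid x|=p^w$ and $(*)$. (c) Fix $\beta,\eta\in R\setminus\{0\}$. There is an algorithm which, given the same data as in (a), answers whether there exists a module in $S'_{\beta,\eta}$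 satisfying $|x\eta=0\,/\,\beta\mid x|=p^w$ and $(*)$. -/

import Mathlib

open scoped DirectSum

universe u

/-- A domain is Prüfer if all its localizations at maximal ideals are valuation domains. -/
class IsPruferDomain (R : Type u) [CommRing R] [IsDomain R] : Prop where
  valuationRing : ∀ (m : Ideal R) [m.IsMaximal], ValuationRing (Localization.AtPrime m)

attribute [instance] IsPruferDomain.valuationRing

/-- The value group of the valuation domain `V` (the group of units of Mathlib's value group with
zero, i.e. `Kˣ / Vˣ` with `K` the fraction field) is densely ordered. -/
def HasDenseValueGroup (V : Type u) [CommRing V] [IsDomain V] [ValuationRing V] : Prop :=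
  DenselyOrdered (ValuationRing.ValueGroup V (FractionRing V))ˣ

/-- Each localization at a maximal ideal has dense value group. -/
def HasDenseValueGroups (R : Type u) [CommRing R] [IsDomain R] [IsPruferDomain R] : Prop :=
  ∀ (m : Ideal R) [m.IsMaximal], HasDenseValueGroup (Localization.AtPrime m)

/-- The list `a 0 = 0, a 1 = 1, a 2, …` (possibly with repetitions) exhibits `R` as an effectively
given ring. -/
structure IsEffectiveListing {R : Type u} [CommRing R] (a : ℕ → R) : Prop where
  surjective : Function.Surjective a
  zero : a 0 = 0
  one : a 1 = 1
  eq_decidable : ComputablePred fun x : ℕ × ℕ => a x.1 = a x.2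
  add_computable : ∃ f : ℕ × ℕ → ℕ, Computable f ∧ ∀ x, a (f x) = a x.1 + a x.2
  mul_computable : ∃ f : ℕ × ℕ → ℕ, Computable f ∧ ∀ x, a (f x) = a x.1 * a x.2
  dvd_decidable : ComputablePred fun x : ℕ × ℕ => a x.1 ∣ a x.2

/-- `(p, n, c₁, …, c_l, d)` (with `l ≥ 1`) belongs to `PP⋆(R)`. -/
def MemPPStar {R : Type u} [CommRing R] (p n : ℕ) (c : List R) (d : R) : Prop :=
  p.Prime ∧ 0 < n ∧ c ≠ [] ∧
    ∃ s : ℕ, 0 < s ∧ ∃ (k : Fin s → ℕ) (m : Fin s → MaximalSpectrum R),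
      (∀ i, 0 < k i) ∧ n ∈ Submodule.span ℕ (Set.range k) ∧
      ∀ i, Nat.card (R ⧸ (m i).asIdeal) = p ^ k i ∧
        (∀ x ∈ c, x ∈ (m i).asIdeal) ∧ d ∉ (m i).asIdeal

/-- `PP⋆(R)` is recursive with respect to the listing `a`. -/
def PPStarRecursive {R : Type u} [CommRing R] (a : ℕ → R) : Prop :=
  ComputablePred fun x : ℕ × ℕ × List ℕ × ℕ =>
    MemPPStar x.1 x.2.1 (x.2.2.1.map a) (a x.2.2.2)

/-- The pp-pairs `xb = 0 / c ∣ x` and `x = x / xd = 0`. -/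
inductive PPPair (R : Type u) : Type u
  | annDvd (b c : R) : PPPair R
  | topAnn (d : R) : PPPair R

namespace PPPair

/-- The subgroup `φ(M)` for the pp-pair `φ / ψ`. -/
def upper {R : Type u} [CommRing R] (M : Type u) [AddCommGroup M] [Module R M] :
    PPPair R → Submodule R M
  | annDvd b _ => LinearMap.ker (LinearMap.lsmul R M b)
  | topAnn _ => ⊤

/-- The subgroup `ψ(M)` for the pp-pair `φ / ψ`. -/
def lower {R : Type u} [CommRing R] (M : Type u) [AddCommGroup M] [Module R M] :
    PPPair R → Submodule R M
  | annDvd _ c => LinearMap.range (LinearMap.lsmul R M c)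
  | topAnn d => LinearMap.ker (LinearMap.lsmul R M d)

/-- The Baur–Monk invariant `|φ(M) : φ(M) ∩ ψ(M)|`, a positive integer or `∞`. -/
noncomputable def invariant {R : Type u} [CommRing R] (π : PPPair R) (M : Type u)
    [AddCommGroup M] [Module R M] : ℕ∞ :=
  ENat.card (π.upper M ⧸ (π.lower M).submoduleOf (π.upper M))

end PPPair

/-- Codes of pp-pairs: `inl (i, j)` is `x aᵢ = 0 / aⱼ ∣ x` and `inr i` is `x = x / x aᵢ = 0`. -/
abbrev PairCode : Type := (ℕ × ℕ) ⊕ ℕ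

/-- The pp-pair with a given code. -/
def PairCode.toPair {R : Type u} (a : ℕ → R) : PairCode → PPPair R
  | Sum.inl (i, j) => PPPair.annDvd (a i) (a j)
  | Sum.inr i => PPPair.topAnn (a i)

/-- The inputs `(p, w, E, U, G)`: `E` lists the pairs `φᵢ/ψᵢ` with their `nᵢ` (`1 ≤ i ≤ t`),
`U` the pairs `φ₂ⱼ/ψ₂ⱼ` (`1 ≤ j ≤ u`), `G` the pairs `φᵢ/ψᵢ` with their `lᵢ`
(`t + 1 ≤ i ≤ t + s`). -/
abbrev InvariantsInput : Type :=
  ℕ × ℕ × List (PairCode × ℕ) × List PairCode × List (PairCode × ℕ)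

/-- `p` is prime and `w` and all `nᵢ`, `lᵢ` are positive. -/
def InvariantsInput.Valid : InvariantsInput → Prop
  | (p, w, E, _, G) => p.Prime ∧ 0 < w ∧ (∀ e ∈ E, 0 < e.2) ∧ ∀ g ∈ G, 0 < g.2

/-- `M` satisfies `|τ| = p ^ w` and the conjunction of
`|φᵢ/ψᵢ| = p ^ nᵢ`, `|φ₂ⱼ/ψ₂ⱼ| = 1` and `|φᵢ/ψᵢ| ≥ p ^ lᵢ`. -/
def InvariantsInput.Holds {R : Type u} [CommRing R] (a : ℕ → R) (τ : PPPair R)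
    (M : Type u) [AddCommGroup M] [Module R M] : InvariantsInput → Prop
  | (p, w, E, U, G) =>
    τ.invariant M = (p ^ w : ℕ) ∧
    (∀ e ∈ E, (PairCode.toPair a e.1).invariant M = (p ^ e.2 : ℕ)) ∧
    (∀ v ∈ U, (PairCode.toPair a v).invariant M = 1) ∧
    ∀ g ∈ G, ((p ^ g.2 : ℕ) : ℕ∞) ≤ (PairCode.toPair a g.1).invariant M

/-- `N_γ(m) = R_m / γ m R_m`, as an `R`-module. -/
abbrev NMod {R : Type u} [CommRing R] (γ : R) (m : MaximalSpectrum R) : Type u :=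
  Localization.AtPrime m.asIdeal ⧸
    (Ideal.span {algebraMap R (Localization.AtPrime m.asIdeal) γ} *
      m.asIdeal.map (algebraMap R (Localization.AtPrime m.asIdeal)))

/-- `N'_{β,η}(m) = m R_m / β η R_m`, as an `R`-module (used for `β, η ∈ m`). -/
abbrev NMod' {R : Type u} [CommRing R] (β η : R) (m : MaximalSpectrum R) : Type u :=
  (m.asIdeal.map (algebraMap R (Localization.AtPrime m.asIdeal))) ⧸
    Submodule.submoduleOf
      (Ideal.span {algebraMap R (Localization.AtPrime m.asIdeal) (β * η)})
      (m.asIdeal.map (algebraMap R (Localization.AtPrime m.asIdeal)))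

/-- `M` is (up to isomorphism) a direct sum `N(m₁) ⊕ ⋯ ⊕ N(m_k)`, `k ≥ 1`, with `m₁, …, m_k`
maximal ideals in `P`. -/
def IsFiniteSumOf {R : Type u} [CommRing R] (N : MaximalSpectrum R → Type u)
    [∀ m, AddCommGroup (N m)] [∀ m, Module R (N m)] (P : Set (MaximalSpectrum R))
    (M : Type u) [AddCommGroup M] [Module R M] : Prop :=
  ∃ k : ℕ, 0 < k ∧ ∃ m : Fin k → MaximalSpectrum R,
    (∀ i, m i ∈ P) ∧ Nonempty (M ≃ₗ[R] ⨁ i, N (m i))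

/-- The class `S_γ`. -/
def ClassS {R : Type u} [CommRing R] (γ : R) (M : Type u) [AddCommGroup M] [Module R M] : Prop :=
  IsFiniteSumOf (fun m => NMod γ m) Set.univ M

/-- The class `T_{β,η}`. -/
def ClassT {R : Type u} [CommRing R] (β η : R) (M : Type u) [AddCommGroup M] [Module R M] :
    Prop :=
  IsFiniteSumOf (fun m => R ⧸ m.asIdeal) {m | β ∈ m.asIdeal ∧ η ∈ m.asIdeal} M

/-- The class `S'_{β,η}`. -/
def ClassS' {R : Type u} [CommRing R] (β η : R) (M : Type u) [AddCommGroup M] [Module R M] :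
    Prop :=
  IsFiniteSumOf (fun m => NMod' β η m) {m | β ∈ m.asIdeal ∧ η ∈ m.asIdeal} M

/-- There is an algorithm which, given any input satisfying `valid`, answers whether `P` holds. -/
def HasAlgorithm {α : Type} [Primcodable α] (valid P : α → Prop) : Prop :=
  ∃ f : α → Bool, Computable f ∧ ∀ x, valid x → (f x = true ↔ P x)

section Computability

variable {α β σ : Type*} [Primcodable α] [Primcodable β] [Primcodable σ]

theorem Computable.list_foldl {f : α → List β} {g : α → σ} {h : α → σ × β → σ}
    (hf : Computable f) (hg : Computable g) (hh : Computable₂ h) :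
    Computable fun a => (f a).foldl (fun s b => h a (s, b)) (g a) := by
  have key : Computable fun a => Nat.rec (motive := fun _ => σ) (g a)
      (fun n s => Option.casesOn ((f a)[n]?) s (fun b => h a (s, b))) (f a).length := by
    refine Computable.nat_rec (h := fun a (q : ℕ × σ) =>
      Option.casesOn ((f a)[q.1]?) q.2 (fun b => h a (q.2, b)))
      (Computable.list_length.comp hf) hg ?_
    refine Computable.option_casesOn
      (o := fun q : α × (ℕ × σ) => (f q.1)[q.2.1]?) (f := fun q => q.2.2)
      (g := fun q b => h q.1 (q.2.2, b)) ?_ ?_ ?_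
    · exact Computable.list_getElem?.comp (hf.comp Computable.fst)
        (Computable.fst.comp Computable.snd)
    · exact Computable.snd.comp Computable.snd
    · exact hh.comp (Computable.fst.comp Computable.fst)
        (Computable.pair (Computable.snd.comp (Computable.snd.comp Computable.fst)) Computable.snd)
  refine key.of_eq fun a => ?_
  have aux : ∀ n, n ≤ (f a).length → Nat.rec (motive := fun _ => σ) (g a)
      (fun n s => Option.casesOn ((f a)[n]?) s (fun b => h a (s, b))) n =
      ((f a).take n).foldl (fun s b => h a (s, b)) (g a) := by
    intro n
    induction n with
    | zero => intro _; simp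
    | succ n ih =>
      intro hn
      have hlt : n < (f a).length := hn
      simp only [ih hlt.le, List.getElem?_eq_getElem hlt]
      rw [← List.take_concat_get' _ _ hlt, List.foldl_append]
      simp
  simpa using aux _ le_rfl

theorem Computable.list_map {f : α → List β} {g : α → β → σ}
    (hf : Computable f) (hg : Computable₂ g) : Computable fun a => (f a).map (g a) := by
  have key : Computable fun a => (f a).foldl (fun s b => s ++ [g a b]) [] :=
    Computable.list_foldl (h := fun a (q : List σ × β) => q.1 ++ [g a q.2]) hf
      (Computable.const []) <| Computable.list_concat.comp (Computable.fst.comp Computable.snd)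
        (hg.comp Computable.fst (Computable.snd.comp Computable.snd))
  refine key.of_eq fun a => ?_
  have aux : ∀ (l : List β) (s : List σ),
      l.foldl (fun s b => s ++ [g a b]) s = s ++ l.map (g a) := by
    intro l
    induction l with
    | nil => simp
    | cons b l ih => intro s; rw [List.foldl_cons, ih]; simp
  simpa using aux (f a) []

theorem Computable.list_flatMap {f : α → List β} {g : α → β → List σ}
    (hf : Computable f) (hg : Computable₂ g) : Computable fun a => (f a).flatMap (g a) :=
  (Primrec.list_flatten.to_comp.comp (Computable.list_map hf hg)).of_eq fun a => by
    rw [List.flatMap_def]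

theorem Computable.list_any {f : α → List β} {g : α → β → Bool}
    (hf : Computable f) (hg : Computable₂ g) : Computable fun a => (f a).any (g a) := by
  have key : Computable fun a => (f a).foldl (fun s b => s || g a b) false :=
    Computable.list_foldl (h := fun a (q : Bool × β) => q.1 || g a q.2) hf
      (Computable.const false) <| Primrec.or.to_comp.comp (Computable.fst.comp Computable.snd)
        (hg.comp Computable.fst (Computable.snd.comp Computable.snd))
  refine key.of_eq fun a => ?_
  have aux : ∀ (l : List β) (s : Bool), l.foldl (fun s b => s || g a b) s = (s || l.any (g a)) := by
    intro l
    induction l with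
    | nil => simp
    | cons b l ih => intro s; simp [ih, Bool.or_assoc]
  simpa using aux (f a) false

theorem Computable.list_all {f : α → List β} {g : α → β → Bool}
    (hf : Computable f) (hg : Computable₂ g) : Computable fun a => (f a).all (g a) :=
  (Primrec.not.to_comp.comp (Computable.list_any (g := fun a b => !g a b) hf
    (Primrec.not.to_comp.comp hg))).of_eq
    fun a => by simp [List.not_any_eq_all_not]

/-- Unbounded search for a witness which is known to exist is computable. -/
theorem Computable.exists_search {P : α → ℕ → Prop}
    (hP : ComputablePred fun x : α × ℕ => P x.1 x.2) (hex : ∀ a, ∃ n, P a n) :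
    ∃ f : α → ℕ, Computable f ∧ ∀ a, P a (f a) := by
  obtain ⟨hd, hc⟩ := hP
  have hd' : ∀ a, DecidablePred (P a) := fun a n => hd (a, n)
  refine ⟨fun a => Nat.find (hex a), ?_, fun a => Nat.find_spec (hex a)⟩
  have : Partrec fun a => Nat.rfind fun n => Part.some (decide (P a n)) := by
    refine Partrec.rfind (p := fun a n => Part.some (decide (P a n))) ?_
    exact Computable.partrec (hc.of_eq fun _ => by congr)
  refine this.of_eq_tot fun a => ?_
  refine Nat.mem_rfind.2 ⟨?_, fun {m} hm => ?_⟩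
  · simpa using Nat.find_spec (hex a)
  · simpa using Nat.find_min (hex a) hm

end Computability

section Search

/-- A cell `(C, D, e)` describes the set of maximal ideals containing all `a c`, `c ∈ C`, and no
`a d`, `d ∈ D`, together with the exponent `e` of an invariant on that set: `(0, 0)` stands for `1`,
`(0, 1)` for the cardinality of the residue field, and `(1, _)` for `∞`. -/
abbrev Cell : Type := List ℕ × List ℕ × (ℕ × ℕ)

/-- A cell carrying the exponents of a list of invariants. -/
abbrev MultiCell : Type := List ℕ × List ℕ × List (ℕ × ℕ)

/-- The common refinement of a list of cell decompositions. -/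
def cellProd (L : List (List Cell)) : List MultiCell :=
  L.foldr (fun A B => A.flatMap fun c => B.map fun c' =>
    (c.1 ++ c'.1, c.2.1 ++ c'.2.1, c.2.2 :: c'.2.2)) [([], [], [])]

theorem cellProd_nil : cellProd [] = [([], [], [])] := rfl

theorem cellProd_cons (A : List Cell) (L : List (List Cell)) :
    cellProd (A :: L) = A.flatMap fun c => (cellProd L).map fun c' =>
      (c.1 ++ c'.1, c.2.1 ++ c'.2.1, c.2.2 :: c'.2.2) := rfl

theorem primrec_cellProd : Primrec cellProd := by
  refine Primrec.list_foldr (f := fun L : List (List Cell) => L) (g := fun _ => [([], [], [])])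
    (h := fun _ (q : List Cell × List MultiCell) => q.1.flatMap fun c => q.2.map fun c' =>
      (c.1 ++ c'.1, c.2.1 ++ c'.2.1, c.2.2 :: c'.2.2)) Primrec.id (Primrec.const _) ?_
  refine Primrec.list_flatMap (f := fun x : List (List Cell) × (List Cell × List MultiCell) => x.2.1)
    (g := fun x c => x.2.2.map fun c' => (c.1 ++ c'.1, c.2.1 ++ c'.2.1, c.2.2 :: c'.2.2))
    (Primrec.fst.comp Primrec.snd) ?_
  refine Primrec.list_map
    (f := fun x : (List (List Cell) × (List Cell × List MultiCell)) × Cell => x.1.2.2)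
    (g := fun x c' => (x.2.1 ++ c'.1, x.2.2.1 ++ c'.2.1, x.2.2.2 :: c'.2.2))
    (Primrec.snd.comp (Primrec.snd.comp Primrec.fst)) ?_
  have hc : Primrec fun x : ((List (List Cell) × (List Cell × List MultiCell)) × Cell) × MultiCell =>
      x.1.2 := Primrec.snd.comp Primrec.fst
  refine Primrec.pair (Primrec.list_append.comp (Primrec.fst.comp hc)
    (Primrec.fst.comp Primrec.snd)) (Primrec.pair (Primrec.list_append.comp
      (Primrec.fst.comp (Primrec.snd.comp hc)) (Primrec.fst.comp (Primrec.snd.comp Primrec.snd)))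
    (Primrec.list_cons.comp (Primrec.snd.comp (Primrec.snd.comp hc))
      (Primrec.snd.comp (Primrec.snd.comp Primrec.snd))))

/-- The exponent vectors which sums of modules over the maximal ideals of one cell, with residue
cardinalities multiplying up to `p ^ n`, `n ≤ w`, can attain. The existence of such sums is
answered by `test`. -/
def cellSteps (test : ℕ × ℕ × List ℕ × List ℕ → Bool) (p w : ℕ) (cells : List MultiCell) :
    List (List (ℕ × ℕ)) :=
  (List.range (w + 1)).flatMap fun n => cells.flatMap fun c =>
    bif test (p, n, c.1, c.2.1) then [c.2.2.map fun e => (n * e.1, n * e.2)] else []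

theorem mem_cellSteps {test : ℕ × ℕ × List ℕ × List ℕ → Bool} {p w : ℕ} {cells : List MultiCell}
    {v : List (ℕ × ℕ)} : v ∈ cellSteps test p w cells ↔
      ∃ n ≤ w, ∃ c ∈ cells, test (p, n, c.1, c.2.1) = true ∧
        v = c.2.2.map fun e => (n * e.1, n * e.2) := by
  simp only [cellSteps, List.mem_flatMap, List.mem_range, Nat.lt_succ_iff]
  refine exists_congr fun n => and_congr_right fun _ => exists_congr fun c => and_congr_right fun _ => ?_
  cases test (p, n, c.1, c.2.1) <;> simp

theorem computable_cellSteps {test : ℕ × ℕ × List ℕ × List ℕ → Bool} (ht : Computable test) :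
    Computable fun x : ℕ × ℕ × List MultiCell => cellSteps test x.1 x.2.1 x.2.2 := by
  have h0 : Computable fun x : ((ℕ × ℕ × List MultiCell) × ℕ) × MultiCell => x.2.2.2 :=
    Computable.snd.comp (Computable.snd.comp Computable.snd)
  have hm : Computable fun x : (((ℕ × ℕ × List MultiCell) × ℕ) × MultiCell) × (ℕ × ℕ) =>
      (x.1.1.2 * x.2.1, x.1.1.2 * x.2.2) :=
    Computable.pair
      (Primrec.nat_mul.to_comp.comp (Computable.snd.comp (Computable.fst.comp Computable.fst))
        (Computable.fst.comp Computable.snd))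
      (Primrec.nat_mul.to_comp.comp (Computable.snd.comp (Computable.fst.comp Computable.fst))
        (Computable.snd.comp Computable.snd))
  have h1 : Computable fun x : ((ℕ × ℕ × List MultiCell) × ℕ) × MultiCell =>
      x.2.2.2.map fun e : ℕ × ℕ => (x.1.2 * e.1, x.1.2 * e.2) :=
    Computable.list_map h0 hm.to₂
  have h2 : Computable fun x : ((ℕ × ℕ × List MultiCell) × ℕ) × MultiCell =>
      (x.1.1.1, x.1.2, x.2.1, x.2.2.1) :=
    Computable.pair (Computable.fst.comp (Computable.fst.comp Computable.fst))
      (Computable.pair (Computable.snd.comp Computable.fst) (Computable.pair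
        (Computable.fst.comp Computable.snd)
        (Computable.fst.comp (Computable.snd.comp Computable.snd))))
  have h3 : Computable fun x : ((ℕ × ℕ × List MultiCell) × ℕ) × MultiCell =>
      bif test (x.1.1.1, x.1.2, x.2.1, x.2.2.1) then
        [x.2.2.2.map fun e : ℕ × ℕ => (x.1.2 * e.1, x.1.2 * e.2)] else [] :=
    Computable.cond (ht.comp h2) (Computable.list_cons.comp h1 (Computable.const []))
      (Computable.const [])
  have hl : Computable fun x : (ℕ × ℕ × List MultiCell) × ℕ => x.1.2.2 :=
    Computable.snd.comp (Computable.snd.comp Computable.fst)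
  have h4 : Computable fun x : (ℕ × ℕ × List MultiCell) × ℕ =>
      x.1.2.2.flatMap fun c => bif test (x.1.1, x.2, c.1, c.2.1) then
        [c.2.2.map fun e : ℕ × ℕ => (x.2 * e.1, x.2 * e.2)] else [] :=
    Computable.list_flatMap hl h3.to₂
  have h5 : Computable fun x : ℕ × ℕ × List MultiCell => List.range (x.2.1 + 1) :=
    Primrec.list_range.to_comp.comp (Computable.succ.comp (Computable.fst.comp Computable.snd))
  exact Computable.list_flatMap h5 h4.to₂

/-- All lists of length at most `n` with entries in `S`. -/
def listsUpTo {β : Type*} (S : List β) (n : ℕ) : List (List β) :=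
  Nat.rec [[]] (fun _ L => [] :: S.flatMap fun s => L.map fun l => s :: l) n

theorem mem_listsUpTo {β : Type*} {S : List β} {n : ℕ} {l : List β} :
    l ∈ listsUpTo S n ↔ l.length ≤ n ∧ ∀ s ∈ l, s ∈ S := by
  induction n generalizing l with
  | zero =>
    have : listsUpTo S 0 = [[]] := rfl
    rw [this]
    constructor
    · intro h; obtain rfl : l = [] := by simpa using h
      simp
    · intro h
      simpa using h.1
  | succ n ih =>
    have : listsUpTo S (n + 1) = [] :: S.flatMap fun s => (listsUpTo S n).map fun l => s :: l := rfl
    rw [this]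
    cases l with
    | nil => simp
    | cons b l =>
      simp only [List.mem_cons, reduceCtorEq, false_or, List.mem_flatMap, List.mem_map,
        List.cons.injEq, List.length_cons, add_le_add_iff_right, forall_eq_or_imp, ih]
      constructor
      · rintro ⟨s, hs, l', h, rfl, rfl⟩
        exact ⟨h.1, hs, h.2⟩
      · rintro ⟨h₁, h₂, h₃⟩
        exact ⟨b, h₂, l, ⟨h₁, h₃⟩, rfl, rfl⟩

theorem primrec_listsUpTo {β : Type*} [Primcodable β] :
    Primrec₂ (listsUpTo : List β → ℕ → List (List β)) := by
  refine Primrec.nat_rec' (f := fun x : List β × ℕ => x.2) (g := fun _ => [[]])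
    (h := fun x q => [] :: x.1.flatMap fun s => q.2.map fun l => s :: l)
    Primrec.snd (Primrec.const _) ?_
  refine Primrec.list_cons.comp (Primrec.const []) (Primrec.list_flatMap
    (f := fun x : (List β × ℕ) × (ℕ × List (List β)) => x.1.1)
    (g := fun x s => x.2.2.map fun l => s :: l) (Primrec.fst.comp Primrec.fst) ?_)
  refine Primrec.list_map (f := fun x : ((List β × ℕ) × (ℕ × List (List β))) × β => x.1.2.2)
    (g := fun x l => x.2 :: l) (Primrec.snd.comp (Primrec.snd.comp Primrec.fst)) ?_
  exact Primrec.list_cons.comp (Primrec.snd.comp Primrec.fst) Primrec.snd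

/-- The `i`-th coordinate of the sum of a list of exponent vectors. -/
def totalAt (l : List (List (ℕ × ℕ))) (i : ℕ) : ℕ × ℕ :=
  l.foldl (fun t v => t + v.getD i (0, 0)) (0, 0)

theorem totalAt_eq_sum (l : List (List (ℕ × ℕ))) (i : ℕ) :
    totalAt l i = (l.map fun v => v.getD i (0, 0)).sum := by
  have aux : ∀ (l : List (List (ℕ × ℕ))) (t : ℕ × ℕ),
      l.foldl (fun t v => t + v.getD i (0, 0)) t = t + (l.map fun v => v.getD i (0, 0)).sum := by
    intro l
    induction l with
    | nil => simp
    | cons v l ih => intro t; rw [List.foldl_cons, ih, List.map_cons, List.sum_cons, add_assoc]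
  rw [totalAt, aux]
  exact zero_add _

theorem computable_totalAt : Computable₂ totalAt := by
  refine Computable.list_foldl (f := fun x : List (List (ℕ × ℕ)) × ℕ => x.1) (g := fun _ => (0, 0))
    (h := fun x q => (q.1.1 + (q.2.getD x.2 (0, 0)).1, q.1.2 + (q.2.getD x.2 (0, 0)).2))
    Computable.fst (Computable.const _) ?_
  have hv : Computable fun x : (List (List (ℕ × ℕ)) × ℕ) × ((ℕ × ℕ) × List (ℕ × ℕ)) =>
      x.2.2.getD x.1.2 (0, 0) :=
    (Primrec.list_getD (0, 0)).to_comp.comp (Computable.snd.comp Computable.snd)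
      (Computable.snd.comp Computable.fst)
  exact Computable.pair
    (Primrec.nat_add.to_comp.comp (Computable.fst.comp (Computable.fst.comp Computable.snd))
      (Computable.fst.comp hv))
    (Primrec.nat_add.to_comp.comp (Computable.snd.comp (Computable.fst.comp Computable.snd))
      (Computable.snd.comp hv))

/-- The condition on the total exponent `t` of an invariant imposed by `= p ^ κ.2`
(if `κ.1 = true`) or `≥ p ^ κ.2` (if `κ.1 = false`). -/
def meets (κ : Bool × ℕ) (t : ℕ × ℕ) : Bool :=
  bif κ.1 then decide (t.1 = 0) && decide (t.2 = κ.2) else !decide (t.1 = 0) || decide (κ.2 ≤ t.2)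

theorem computable_meets : Computable₂ meets := by
  have h0 : Computable fun x : (Bool × ℕ) × (ℕ × ℕ) => decide (x.2.1 = 0) :=
    Primrec.beq.to_comp.comp (Computable.fst.comp Computable.snd) (Computable.const 0)
  have h1 : Computable fun x : (Bool × ℕ) × (ℕ × ℕ) => decide (x.2.2 = x.1.2) :=
    Primrec.beq.to_comp.comp (Computable.snd.comp Computable.snd)
      (Computable.snd.comp Computable.fst)
  have h2 : Computable fun x : (Bool × ℕ) × (ℕ × ℕ) => decide (x.1.2 ≤ x.2.2) :=
    (Primrec.nat_le.decide.to_comp).comp (Computable.snd.comp Computable.fst)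
      (Computable.snd.comp Computable.snd)
  exact Computable.cond (Computable.fst.comp Computable.fst) (Primrec.and.to_comp.comp h0 h1)
    (Primrec.or.to_comp.comp (Primrec.not.to_comp.comp h0) h2)

/-- The list of all conditions on invariants in an input, the one on `τ` coming first. -/
def InvariantsInput.constraints (τ : PairCode) (σ : InvariantsInput) :
    List (PairCode × Bool × ℕ) :=
  (τ, true, σ.2.1) :: (σ.2.2.1.map (fun e => (e.1, true, e.2)) ++
    (σ.2.2.2.1.map (fun v => (v, true, 0)) ++ σ.2.2.2.2.map fun g => (g.1, false, g.2)))

theorem InvariantsInput.computable_constraints (τ : PairCode) :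
    Computable (InvariantsInput.constraints τ) := by
  refine Primrec.to_comp ?_
  have h2 : Primrec fun σ : InvariantsInput => σ.2.2 := Primrec.snd.comp Primrec.snd
  refine Primrec.list_cons.comp (Primrec.pair (Primrec.const τ) (Primrec.pair (Primrec.const true)
    (Primrec.fst.comp Primrec.snd))) (Primrec.list_append.comp ?_ (Primrec.list_append.comp ?_ ?_))
  · refine Primrec.list_map (f := fun σ : InvariantsInput => σ.2.2.1)
      (g := fun _ e => (e.1, true, e.2)) (Primrec.fst.comp h2) ?_
    exact Primrec.pair (Primrec.fst.comp Primrec.snd)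
      (Primrec.pair (Primrec.const true) (Primrec.snd.comp Primrec.snd))
  · refine Primrec.list_map (f := fun σ : InvariantsInput => σ.2.2.2.1)
      (g := fun _ v => (v, true, 0)) (Primrec.fst.comp (Primrec.snd.comp h2)) ?_
    exact Primrec.pair Primrec.snd (Primrec.const (true, 0))
  · refine Primrec.list_map (f := fun σ : InvariantsInput => σ.2.2.2.2)
      (g := fun _ g => (g.1, false, g.2)) (Primrec.snd.comp (Primrec.snd.comp h2)) ?_
    exact Primrec.pair (Primrec.fst.comp Primrec.snd)
      (Primrec.pair (Primrec.const false) (Primrec.snd.comp Primrec.snd))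

/-- The exponent vectors available for the constraints of an input. -/
def inputSteps (test : ℕ × ℕ × List ℕ × List ℕ → Bool) (cells : PairCode → List Cell)
    (τ : PairCode) (σ : InvariantsInput) : List (List (ℕ × ℕ)) :=
  cellSteps test σ.1 σ.2.1 (cellProd ((σ.constraints τ).map fun κ => cells κ.1))

/-- The search for a list of exponent vectors whose sum meets all constraints of the input. -/
def decideInput (test : ℕ × ℕ × List ℕ × List ℕ → Bool) (cells : PairCode → List Cell)
    (τ : PairCode) (σ : InvariantsInput) : Bool :=
  (listsUpTo (inputSteps test cells τ σ) σ.2.1).any fun l =>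
    (List.range (σ.constraints τ).length).all fun i =>
      meets ((σ.constraints τ).getD i (τ, true, 0)).2 (totalAt l i)

theorem computable_inputSteps {test : ℕ × ℕ × List ℕ × List ℕ → Bool} (ht : Computable test)
    {cells : PairCode → List Cell} (hc : Computable cells) (τ : PairCode) :
    Computable (inputSteps test cells τ) := by
  have hK := InvariantsInput.computable_constraints τ
  have hw : Computable fun σ : InvariantsInput => σ.2.1 := Computable.fst.comp Computable.snd
  have hκ : Computable fun x : InvariantsInput × (PairCode × Bool × ℕ) => cells x.2.1 :=
    hc.comp (Computable.fst.comp Computable.snd)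
  have hL : Computable fun σ : InvariantsInput => (σ.constraints τ).map fun κ => cells κ.1 :=
    Computable.list_map hK hκ.to₂
  have hC : Computable fun σ : InvariantsInput =>
      cellProd ((σ.constraints τ).map fun κ => cells κ.1) := primrec_cellProd.to_comp.comp hL
  have hP : Computable fun σ : InvariantsInput =>
      (σ.1, σ.2.1, cellProd ((σ.constraints τ).map fun κ => cells κ.1)) :=
    Computable.pair Computable.fst (Computable.pair hw hC)
  exact ((computable_cellSteps ht).comp hP).of_eq fun _ => rfl

theorem computable_meets_constraint (τ : PairCode) :
    Computable fun x : (InvariantsInput × List (List (ℕ × ℕ))) × ℕ =>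
      meets ((x.1.1.constraints τ).getD x.2 (τ, true, 0)).2 (totalAt x.1.2 x.2) := by
  have hK := InvariantsInput.computable_constraints τ
  have h0 : Computable fun x : (InvariantsInput × List (List (ℕ × ℕ))) × ℕ =>
      x.1.1.constraints τ := hK.comp (Computable.fst.comp Computable.fst)
  have h1 : Computable fun x : (InvariantsInput × List (List (ℕ × ℕ))) × ℕ =>
      (x.1.1.constraints τ).getD x.2 (τ, true, 0) :=
    (Primrec.list_getD _).to_comp.comp h0 Computable.snd
  have h2 : Computable fun x : (InvariantsInput × List (List (ℕ × ℕ))) × ℕ =>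
      totalAt x.1.2 x.2 :=
    computable_totalAt.comp (Computable.snd.comp Computable.fst) Computable.snd
  exact computable_meets.comp (Computable.snd.comp h1) h2

theorem computable_decideInput {test : ℕ × ℕ × List ℕ × List ℕ → Bool} (ht : Computable test)
    {cells : PairCode → List Cell} (hc : Computable cells) (τ : PairCode) :
    Computable (decideInput test cells τ) := by
  have hK := InvariantsInput.computable_constraints τ
  have hw : Computable fun σ : InvariantsInput => σ.2.1 := Computable.fst.comp Computable.snd
  have hS := computable_inputSteps ht hc τ
  have h3 : Computable fun x : InvariantsInput × List (List (ℕ × ℕ)) =>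
      List.range (x.1.constraints τ).length :=
    Primrec.list_range.to_comp.comp (Computable.list_length.comp (hK.comp Computable.fst))
  have h4 : Computable fun x : InvariantsInput × List (List (ℕ × ℕ)) =>
      (List.range (x.1.constraints τ).length).all fun i =>
        meets ((x.1.constraints τ).getD i (τ, true, 0)).2 (totalAt x.2 i) :=
    Computable.list_all h3 (computable_meets_constraint τ).to₂
  have h5 : Computable fun σ : InvariantsInput => listsUpTo (inputSteps test cells τ σ) σ.2.1 :=
    primrec_listsUpTo.to_comp.comp hS hw
  exact Computable.list_any h5 h4.to₂

theorem decideInput_eq_true_iff {test : ℕ × ℕ × List ℕ × List ℕ → Bool}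
    {cells : PairCode → List Cell} {τ : PairCode} {σ : InvariantsInput} :
    decideInput test cells τ σ = true ↔ ∃ l : List (List (ℕ × ℕ)), l.length ≤ σ.2.1 ∧
      (∀ v ∈ l, v ∈ inputSteps test cells τ σ) ∧
      ∀ (i : ℕ) (hi : i < (σ.constraints τ).length),
        meets ((σ.constraints τ)[i]).2 (l.map fun v => v.getD i (0, 0)).sum = true := by
  simp only [decideInput, List.any_eq_true, mem_listsUpTo, List.all_eq_true, List.mem_range,
    totalAt_eq_sum, and_assoc]
  refine exists_congr fun l => and_congr_right fun _ => and_congr_right fun _ =>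
    forall_congr' fun i => forall_congr' fun hi => ?_
  rw [List.getD_eq_getElem _ _ hi]

end Search

section Invariants

variable {R : Type u} [CommRing R]

theorem Submodule.nonempty_quotient_submoduleOf_equiv {M Q : Type*} [AddCommGroup M] [Module R M]
    [AddCommGroup Q] [Module R Q] {U L : Submodule R M} (f : U →ₗ[R] Q)
    (hf : Function.Surjective f) (hker : ∀ x, f x = 0 ↔ (x : M) ∈ L) :
    Nonempty ((U ⧸ L.submoduleOf U) ≃ₗ[R] Q) := by
  have h : L.submoduleOf U = LinearMap.ker f := by
    ext x
    rw [LinearMap.mem_ker, hker]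
    rfl
  exact ⟨(Submodule.quotEquivOfEq _ _ h).trans (f.quotKerEquivOfSurjective hf)⟩

theorem ENat.card_pi {k : ℕ} (Q : Fin k → Type*) :
    ENat.card (∀ i, Q i) = ∏ i, ENat.card (Q i) := by
  induction k with
  | zero => simp
  | succ k ih =>
    rw [Fin.prod_univ_succ, ← ih, ← ENat.card_prod]
    exact ENat.card_congr (Fin.consEquiv Q).symm

namespace PPPair

variable {M M' : Type u} [AddCommGroup M] [Module R M] [AddCommGroup M'] [Module R M']

@[simp]
theorem mem_upper_annDvd {b c : R} {x : M} : x ∈ (annDvd b c).upper M ↔ b • x = 0 := Iff.rfl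

@[simp]
theorem mem_upper_topAnn {d : R} {x : M} : x ∈ (topAnn d).upper M ↔ True := by
  simp [upper]

@[simp]
theorem mem_lower_annDvd {b c : R} {x : M} :
    x ∈ (annDvd b c).lower M ↔ ∃ y, c • y = x := Iff.rfl

@[simp]
theorem mem_lower_topAnn {d : R} {x : M} : x ∈ (topAnn d).lower M ↔ d • x = 0 := Iff.rfl

theorem mem_upper_map (e : M ≃ₗ[R] M') (π : PPPair R) {x : M} :
    e x ∈ π.upper M' ↔ x ∈ π.upper M := by
  cases π with
  | annDvd b c => simp [← map_smul]
  | topAnn d => simp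

theorem mem_lower_map (e : M ≃ₗ[R] M') (π : PPPair R) {x : M} :
    e x ∈ π.lower M' ↔ x ∈ π.lower M := by
  cases π with
  | annDvd b c =>
    simp only [mem_lower_annDvd]
    constructor
    · rintro ⟨y, hy⟩
      exact ⟨e.symm y, by rw [← map_smul, hy, e.symm_apply_apply]⟩
    · rintro ⟨y, rfl⟩
      exact ⟨e y, (map_smul e c y).symm⟩
  | topAnn d => simp [← map_smul]

theorem invariant_congr (e : M ≃ₗ[R] M') (π : PPPair R) : π.invariant M = π.invariant M' := by
  let f : π.upper M →ₗ[R] π.upper M' :=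
    e.toLinearMap.restrict fun x hx => (mem_upper_map e π).2 hx
  obtain ⟨g⟩ := Submodule.nonempty_quotient_submoduleOf_equiv (L := π.lower M)
    (((π.lower M').submoduleOf (π.upper M')).mkQ ∘ₗ f) (by
      refine (Submodule.mkQ_surjective _).comp fun y => ?_
      exact ⟨⟨e.symm y, (mem_upper_map e π).1 (by simp)⟩, Subtype.ext (by simp [f])⟩) (fun x => by
      rw [LinearMap.comp_apply, Submodule.mkQ_apply, Submodule.Quotient.mk_eq_zero]
      exact mem_lower_map e π)
  exact ENat.card_congr g.toEquiv

theorem mem_upper_pi {ι : Type} {N : ι → Type u} [∀ i, AddCommGroup (N i)] [∀ i, Module R (N i)]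
    (π : PPPair R) {x : ∀ i, N i} : x ∈ π.upper (∀ i, N i) ↔ ∀ i, x i ∈ π.upper (N i) := by
  cases π with
  | annDvd b c => simp [funext_iff]
  | topAnn d => simp

theorem mem_lower_pi {ι : Type} {N : ι → Type u} [∀ i, AddCommGroup (N i)] [∀ i, Module R (N i)]
    (π : PPPair R) {x : ∀ i, N i} : x ∈ π.lower (∀ i, N i) ↔ ∀ i, x i ∈ π.lower (N i) := by
  cases π with
  | annDvd b c => simp [funext_iff, Classical.skolem]
  | topAnn d => simp [funext_iff]

theorem invariant_pi {k : ℕ} (N : Fin k → Type u) [∀ i, AddCommGroup (N i)]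
    [∀ i, Module R (N i)] (π : PPPair R) :
    π.invariant (∀ i, N i) = ∏ i, π.invariant (N i) := by
  let f : π.upper (∀ i, N i) →ₗ[R] ∀ i, π.upper (N i) ⧸ (π.lower (N i)).submoduleOf (π.upper (N i)) :=
    LinearMap.pi fun i => ((π.lower (N i)).submoduleOf (π.upper (N i))).mkQ ∘ₗ
      (LinearMap.proj i).restrict fun x hx => (mem_upper_pi π).1 hx i
  obtain ⟨g⟩ := Submodule.nonempty_quotient_submoduleOf_equiv (L := π.lower (∀ i, N i)) f (by
      intro y
      choose z hz using fun i => Submodule.mkQ_surjective _ (y i)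
      exact ⟨⟨fun i => z i, (mem_upper_pi π).2 fun i => (z i).2⟩, funext fun i => hz i⟩) (fun x => by
      rw [mem_lower_pi, funext_iff]
      refine forall_congr' fun i => ?_
      change Submodule.mkQ _ _ = 0 ↔ _
      rw [Submodule.mkQ_apply, Submodule.Quotient.mk_eq_zero]
      rfl)
  rw [invariant, ENat.card_congr g.toEquiv, ENat.card_pi]
  rfl

theorem invariant_directSum {k : ℕ} (N : Fin k → Type u) [∀ i, AddCommGroup (N i)]
    [∀ i, Module R (N i)] (π : PPPair R) :
    π.invariant (⨁ i, N i) = ∏ i, π.invariant (N i) := by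
  rw [← invariant_pi]
  exact invariant_congr (DirectSum.linearEquivFunOnFintype R (Fin k) N) π

theorem invariant_eq_one_of_le {π : PPPair R} (h : π.upper M ≤ π.lower M) :
    π.invariant M = 1 := by
  rw [invariant, ENat.card_eq_one_iff_unique]
  have : Subsingleton (π.upper M ⧸ (π.lower M).submoduleOf (π.upper M)) := by
    rw [Submodule.Quotient.subsingleton_iff, eq_top_iff]
    exact fun x _ => h x.2
  exact ⟨Unique.mk' _⟩

theorem invariant_eq_top_of_seq {π : PPPair R} (x : ℕ → M) (hx : ∀ i, x i ∈ π.upper M)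
    (hne : ∀ i j, i < j → x i - x j ∉ π.lower M) : π.invariant M = ⊤ := by
  rw [invariant, ENat.card_eq_top]
  refine Infinite.of_injective
    (fun i => Submodule.Quotient.mk (p := (π.lower M).submoduleOf (π.upper M)) ⟨x i, hx i⟩) ?_
  intro i j hij
  rw [Submodule.Quotient.eq] at hij
  have hij' : x i - x j ∈ π.lower M := hij
  rcases lt_trichotomy i j with h | h | h
  · exact absurd hij' (hne i j h)
  · exact h
  · refine absurd ?_ (hne j i h)
    rw [← neg_sub]
    exact neg_mem hij'

theorem invariant_eq_card_quotient {A : Type*} [AddCommGroup A] [Module R A] {π : PPPair R}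
    (I : Submodule R A) (g : A →ₗ[R] M) (hupper : ∀ v, g v ∈ π.upper M)
    (hsurj : ∀ x ∈ π.upper M, ∃ v, x - g v ∈ π.lower M)
    (hlower : ∀ v, g v ∈ π.lower M ↔ v ∈ I) : π.invariant M = ENat.card (A ⧸ I) := by
  let f : A →ₗ[R] π.upper M ⧸ (π.lower M).submoduleOf (π.upper M) :=
    ((π.lower M).submoduleOf (π.upper M)).mkQ ∘ₗ g.codRestrict _ hupper
  have hf : Function.Surjective f := by
    intro y
    obtain ⟨x, rfl⟩ := Submodule.mkQ_surjective _ y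
    obtain ⟨v, hv⟩ := hsurj x x.2
    refine ⟨v, ?_⟩
    change Submodule.Quotient.mk _ = Submodule.Quotient.mk _
    rw [eq_comm, Submodule.Quotient.eq]
    exact hv
  have hker : I = LinearMap.ker f := by
    ext v
    rw [LinearMap.mem_ker, ← hlower]
    exact (Submodule.Quotient.mk_eq_zero ((π.lower M).submoduleOf (π.upper M))
      (x := ⟨g v, hupper v⟩)).symm
  exact ENat.card_congr
    ((Submodule.quotEquivOfEq _ _ hker).trans (f.quotKerEquivOfSurjective hf)).symm.toEquiv

end PPPair

end Invariants

section Exponents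

/-- The invariant with exponent `e`: `q ^ e.2` if `e.1 = 0`, and `∞` otherwise. -/
def powExp (q : ℕ∞) (e : ℕ × ℕ) : ℕ∞ := if e.1 = 0 then q ^ e.2 else ⊤

@[simp]
theorem powExp_zero (q : ℕ∞) : powExp q 0 = 1 := by simp [powExp]

theorem powExp_add {p : ℕ} (hp : p ≠ 0) (s t : ℕ × ℕ) :
    powExp p (s + t) = powExp p s * powExp p t := by
  have hpow : ∀ n : ℕ, ((p : ℕ∞) ^ n) ≠ 0 := fun n => pow_ne_zero n (by exact_mod_cast hp)
  by_cases hs : s.1 = 0 <;> by_cases ht : t.1 = 0 <;>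
    simp [powExp, hs, ht, pow_add, ENat.top_mul, ENat.mul_top, hpow]

theorem powExp_pow {p k : ℕ} (hk : 0 < k) (e : ℕ × ℕ) :
    powExp ((p ^ k : ℕ) : ℕ∞) e = powExp p (k * e.1, k * e.2) := by
  simp [powExp, hk.ne', pow_mul]

theorem powExp_list_sum {β : Type*} {p : ℕ} (hp : p ≠ 0) (f : β → ℕ × ℕ) (l : List β) :
    powExp p (l.map f).sum = (l.map fun b => powExp p (f b)).prod := by
  induction l with
  | nil => simp
  | cons b l ih => simp only [List.map_cons, List.sum_cons, List.prod_cons, powExp_add hp, ih]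

theorem prod_powExp_pow {ι : Type*} {p : ℕ} (hp : p ≠ 0) (k : ι → ℕ) (hk : ∀ i, 0 < k i)
    (e : ℕ × ℕ) (l : List ι) : (l.map fun i => powExp ((p ^ k i : ℕ) : ℕ∞) e).prod =
      powExp p ((l.map k).sum * e.1, (l.map k).sum * e.2) := by
  induction l with
  | nil => simp [powExp]
  | cons i l ih =>
    rw [List.map_cons, List.prod_cons, ih, powExp_pow (hk i), ← powExp_add hp]
    simp [add_mul]

/-- The condition `x = p ^ κ.2` (if `κ.1 = true`) or `x ≥ p ^ κ.2` (if `κ.1 = false`). -/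
def MeetsInvariant (p : ℕ) (κ : Bool × ℕ) (x : ℕ∞) : Prop :=
  bif κ.1 then x = (p ^ κ.2 : ℕ) else ((p ^ κ.2 : ℕ) : ℕ∞) ≤ x

theorem meets_iff {p : ℕ} (hp : 2 ≤ p) (κ : Bool × ℕ) (t : ℕ × ℕ) :
    meets κ t = true ↔ MeetsInvariant p κ (powExp p t) := by
  obtain ⟨b, n⟩ := κ
  by_cases ht : t.1 = 0
  · cases b
    · simp only [meets, MeetsInvariant, powExp, ht, cond_false, if_true, decide_true,
        Bool.not_true, Bool.false_or, decide_eq_true_eq, ← Nat.cast_pow, Nat.cast_le]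
      exact (Nat.pow_le_pow_iff_right hp).symm
    · simp only [meets, MeetsInvariant, powExp, ht, cond_true, if_true, decide_true,
        Bool.true_and, decide_eq_true_eq, ← Nat.cast_pow, Nat.cast_inj]
      exact (Nat.pow_right_injective hp).eq_iff.symm
  · cases b
    · simp [meets, MeetsInvariant, powExp, ht]
    · simp only [meets, MeetsInvariant, powExp, ht, cond_true, if_false, decide_false,
        Bool.false_and, Bool.false_eq_true, false_iff]
      exact ENat.top_ne_natCast _

theorem exists_list_sum_of_mem_span {ι : Type*} {k : ι → ℕ} {n : ℕ}
    (h : n ∈ Submodule.span ℕ (Set.range k)) : ∃ l : List ι, (l.map k).sum = n := by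
  induction h using Submodule.span_induction with
  | mem x hx =>
    obtain ⟨i, rfl⟩ := hx
    exact ⟨[i], by simp⟩
  | zero => exact ⟨[], rfl⟩
  | add x y _ _ hx hy =>
    obtain ⟨l, rfl⟩ := hx
    obtain ⟨l', rfl⟩ := hy
    exact ⟨l ++ l', by simp⟩
  | smul c x _ hx =>
    obtain ⟨l, rfl⟩ := hx
    induction c with
    | zero => exact ⟨[], by simp⟩
    | succ c ih =>
      obtain ⟨l', hl'⟩ := ih
      exact ⟨l' ++ l, by simp [hl', add_mul]⟩

theorem exists_pow_of_list_prod_eq {β : Type*} {p : ℕ} (hp : p.Prime) (f : β → ℕ∞) (l : List β)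
    (hf : ∀ b ∈ l, 1 < f b) {w : ℕ} (h : (l.map f).prod = (p ^ w : ℕ)) :
    l.length ≤ w ∧ ∀ b ∈ l, ∃ k, 0 < k ∧ k ≤ w ∧ f b = (p ^ k : ℕ) := by
  induction l generalizing w with
  | nil => simp
  | cons b l ih =>
    rw [List.map_cons, List.prod_cons] at h
    have hb : 1 < f b := hf b (by simp)
    have hne : f b * (l.map f).prod ≠ ⊤ := h ▸ ENat.natCast_ne_top _
    have hpos : f b * (l.map f).prod ≠ 0 := by
      rw [h]
      exact_mod_cast (pow_pos hp.pos w).ne'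
    have hb0 := left_ne_zero_of_mul hpos
    have hl0 := right_ne_zero_of_mul hpos
    have hbt : f b ≠ ⊤ := fun e => hne (by rw [e, ENat.top_mul hl0])
    have hlt : (l.map f).prod ≠ ⊤ := fun e => hne (by rw [e, ENat.mul_top hb0])
    obtain ⟨x, hx⟩ := ENat.ne_top_iff_exists.1 hbt
    obtain ⟨y, hy⟩ := ENat.ne_top_iff_exists.1 hlt
    rw [← hx, ← hy, ← Nat.cast_mul, Nat.cast_inj] at h
    obtain ⟨i, _, rfl⟩ := (Nat.dvd_prime_pow hp).1 (Dvd.intro _ h)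
    obtain ⟨j, _, rfl⟩ := (Nat.dvd_prime_pow hp).1 (Dvd.intro_left _ h)
    have hij : i + j = w := by
      rw [← pow_add] at h
      exact Nat.pow_right_injective hp.two_le h
    have hi : 0 < i := by
      rcases Nat.eq_zero_or_pos i with rfl | hi
      · rw [← hx] at hb
        simp at hb
      · exact hi
    obtain ⟨h1, h2⟩ := ih (fun c hc => hf c (by simp [hc])) hy.symm
    refine ⟨by rw [List.length_cons]; omega, fun c hc => ?_⟩
    rcases List.mem_cons.1 hc with rfl | hc
    · exact ⟨i, hi, by omega, hx.symm⟩
    · obtain ⟨k, hk, hkj, e⟩ := h2 c hc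
      exact ⟨k, hk, by omega, e⟩

end Exponents

section Correctness

variable {R : Type u} [CommRing R]

/-- The maximal ideal `m` contains `a c` for `c ∈ C` and does not contain `a d` for `d ∈ D`. -/
def InCell (a : ℕ → R) (m : MaximalSpectrum R) (C D : List ℕ) : Prop :=
  (∀ c ∈ C, a c ∈ m.asIdeal) ∧ ∀ d ∈ D, a d ∉ m.asIdeal

theorem inCell_append {a : ℕ → R} {m : MaximalSpectrum R} {C C' D D' : List ℕ} :
    InCell a m (C ++ C') (D ++ D') ↔ InCell a m C D ∧ InCell a m C' D' := by
  simp only [InCell, List.mem_append, or_imp, forall_and]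
  tauto

/-- For each code of a pair, `cells` lists cells which cover the maximal ideals in `P` and on which
the invariant of `N m` is given by the exponent of the cell. -/
structure IsCellDecomposition (a : ℕ → R) (N : MaximalSpectrum R → Type u)
    [∀ m, AddCommGroup (N m)] [∀ m, Module R (N m)] (P : Set (MaximalSpectrum R))
    (cells : PairCode → List Cell) : Prop where
  cover : ∀ m ∈ P, ∀ π, ∃ c ∈ cells π, InCell a m c.1 c.2.1
  value : ∀ m ∈ P, ∀ π, ∀ c ∈ cells π, InCell a m c.1 c.2.1 →
    (PairCode.toPair a π).invariant (N m) = powExp (ENat.card (R ⧸ m.asIdeal)) c.2.2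

variable {a : ℕ → R} {N : MaximalSpectrum R → Type u} [∀ m, AddCommGroup (N m)]
  [∀ m, Module R (N m)] {P : Set (MaximalSpectrum R)} {cells : PairCode → List Cell}

theorem IsCellDecomposition.cellProd_cover (hcells : IsCellDecomposition a N P cells)
    {m : MaximalSpectrum R} (hm : m ∈ P) (K : List (PairCode × Bool × ℕ)) :
    ∃ c ∈ cellProd (K.map fun κ => cells κ.1), InCell a m c.1 c.2.1 := by
  induction K with
  | nil => exact ⟨([], [], []), by simp [cellProd_nil], by simp [InCell]⟩
  | cons κ K ih =>
    obtain ⟨c', hc', h'⟩ := ih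
    obtain ⟨c, hc, h⟩ := hcells.cover m hm κ.1
    refine ⟨(c.1 ++ c'.1, c.2.1 ++ c'.2.1, c.2.2 :: c'.2.2), ?_, inCell_append.2 ⟨h, h'⟩⟩
    rw [List.map_cons, cellProd_cons]
    exact List.mem_flatMap.2 ⟨c, hc, List.mem_map.2 ⟨c', hc', rfl⟩⟩

theorem IsCellDecomposition.cellProd_value (hcells : IsCellDecomposition a N P cells)
    {m : MaximalSpectrum R} (hm : m ∈ P) (K : List (PairCode × Bool × ℕ)) {c : MultiCell}
    (hc : c ∈ cellProd (K.map fun κ => cells κ.1)) (h : InCell a m c.1 c.2.1) (i : ℕ)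
    (hi : i < K.length) : (PairCode.toPair a K[i].1).invariant (N m) =
      powExp (ENat.card (R ⧸ m.asIdeal)) (c.2.2.getD i (0, 0)) := by
  induction K generalizing c i with
  | nil => simp at hi
  | cons κ K ih =>
    rw [List.map_cons, cellProd_cons] at hc
    obtain ⟨c₁, hc₁, hc⟩ := List.mem_flatMap.1 hc
    obtain ⟨c₂, hc₂, rfl⟩ := List.mem_map.1 hc
    obtain ⟨h₁, h₂⟩ := inCell_append.1 h
    cases i with
    | zero => exact hcells.value m hm κ.1 c₁ hc₁ h₁
    | succ i => exact ih hc₂ h₂ i (by simpa using hi)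

/-- `test` decides `PP⋆(R)` for tuples which contain the `a c`, `c ∈ C₀`. -/
def DecidesPPStar (a : ℕ → R) (C₀ : List ℕ) (test : ℕ × ℕ × List ℕ × List ℕ → Bool) : Prop :=
  ∀ p n C D, test (p, n, C, D) = true ↔ MemPPStar p n ((C₀ ++ C).map a) (D.map a).prod

theorem exists_decidesPPStar (ha : IsEffectiveListing a) (hPP : PPStarRecursive a)
    (C₀ : List ℕ) : ∃ test, Computable test ∧ DecidesPPStar a C₀ test := by
  obtain ⟨mul, hmul, hmul'⟩ := ha.mul_computable
  obtain ⟨_, hPPc⟩ := hPP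
  have hmul₂ : Computable fun x : (ℕ × ℕ × List ℕ × List ℕ) × (ℕ × ℕ) => mul x.2 :=
    hmul.comp Computable.snd
  have hD : Computable fun x : ℕ × ℕ × List ℕ × List ℕ => x.2.2.2 :=
    Computable.snd.comp (Computable.snd.comp Computable.snd)
  have hprod : Computable fun x : ℕ × ℕ × List ℕ × List ℕ =>
      x.2.2.2.foldl (fun s d => mul (s, d)) 1 :=
    Computable.list_foldl hD (Computable.const 1) hmul₂.to₂
  have hC : Computable fun x : ℕ × ℕ × List ℕ × List ℕ => C₀ ++ x.2.2.1 :=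
    Computable.list_append.comp (Computable.const C₀)
      (Computable.fst.comp (Computable.snd.comp Computable.snd))
  have hin : Computable fun x : ℕ × ℕ × List ℕ × List ℕ =>
      (x.1, x.2.1, C₀ ++ x.2.2.1, x.2.2.2.foldl (fun s d => mul (s, d)) 1) :=
    Computable.pair Computable.fst (Computable.pair (Computable.fst.comp Computable.snd)
      (Computable.pair hC hprod))
  refine ⟨_, hPPc.comp hin, fun p n C D => ?_⟩
  have aux : ∀ (D : List ℕ) (s : ℕ),
      a (D.foldl (fun s d => mul (s, d)) s) = a s * (D.map a).prod := by
    intro D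
    induction D with
    | nil => simp
    | cons d D ih => intro s; rw [List.foldl_cons, ih, hmul', List.map_cons, List.prod_cons, mul_assoc]
  rw [decide_eq_true_eq]
  simp only [aux, ha.one, one_mul]

theorem prod_map_notMem_iff {m : MaximalSpectrum R} {D : List ℕ} :
    (D.map a).prod ∉ m.asIdeal ↔ ∀ d ∈ D, a d ∉ m.asIdeal := by
  induction D with
  | nil => simpa using (Ideal.ne_top_iff_one _).1 m.isMaximal.ne_top
  | cons d D ih =>
    rw [List.map_cons, List.prod_cons, m.isMaximal.isPrime.mul_mem_iff_mem_or_mem, not_or, ih]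
    simp

variable {C₀ : List ℕ} {test : ℕ × ℕ × List ℕ × List ℕ → Bool} {τ : PairCode}
  {σ : InvariantsInput}

theorem exists_inputStep (hcells : IsCellDecomposition a N P cells) (hC₀ : C₀ ≠ [])
    (hP : ∀ m, m ∈ P ↔ ∀ c ∈ C₀, a c ∈ m.asIdeal) (ht : DecidesPPStar a C₀ test)
    (hp : σ.1.Prime) {m : MaximalSpectrum R} (hm : m ∈ P) {k : ℕ} (hk : 0 < k) (hkw : k ≤ σ.2.1)
    (hcard : ENat.card (R ⧸ m.asIdeal) = (σ.1 ^ k : ℕ)) :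
    ∃ v ∈ inputSteps test cells τ σ, ∀ (i : ℕ) (hi : i < (σ.constraints τ).length),
      (PairCode.toPair a (σ.constraints τ)[i].1).invariant (N m) =
        powExp σ.1 (v.getD i (0, 0)) := by
  obtain ⟨c, hc, hmc⟩ := hcells.cellProd_cover hm (σ.constraints τ)
  refine ⟨_, mem_cellSteps.2 ⟨k, hkw, c, hc, ?_, rfl⟩, fun i hi => ?_⟩
  · rw [ht]
    refine ⟨hp, hk, by simp [hC₀], 1, one_pos, fun _ => k, fun _ => m, fun _ => hk,
      Submodule.subset_span ⟨0, rfl⟩, fun _ => ⟨?_, ?_, prod_map_notMem_iff.2 hmc.2⟩⟩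
    · rw [Nat.card, ← ENat.toNat_natCast (σ.1 ^ k), ← hcard]
      rfl
    · intro x hx
      obtain ⟨c, hc, rfl⟩ := List.mem_map.1 hx
      rcases List.mem_append.1 hc with hc | hc
      · exact (hP m).1 hm c hc
      · exact hmc.1 c hc
  · rw [hcells.cellProd_value hm _ hc hmc i hi, hcard, powExp_pow hk]
    congr 1
    exact (List.getD_map _ (0, 0) fun e : ℕ × ℕ => (k * e.1, k * e.2)).symm

theorem exists_list_of_mem_inputSteps (hcells : IsCellDecomposition a N P cells)
    (hP : ∀ m, m ∈ P ↔ ∀ c ∈ C₀, a c ∈ m.asIdeal) (ht : DecidesPPStar a C₀ test)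
    {v : List (ℕ × ℕ)} (hv : v ∈ inputSteps test cells τ σ) :
    ∃ ms : List (MaximalSpectrum R), (∀ m ∈ ms, m ∈ P) ∧
      ∀ (i : ℕ) (hi : i < (σ.constraints τ).length),
        (ms.map fun m => (PairCode.toPair a (σ.constraints τ)[i].1).invariant (N m)).prod =
          powExp σ.1 (v.getD i (0, 0)) := by
  obtain ⟨n, -, c, hc, hmem, rfl⟩ := mem_cellSteps.1 hv
  obtain ⟨hp, -, -, s, -, k, m, hk, hn, hm⟩ := (ht _ _ _ _).1 hmem
  obtain ⟨l, rfl⟩ := exists_list_sum_of_mem_span hn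
  have hmP : ∀ i, m i ∈ P := fun i => (hP _).2 fun x hx =>
    (hm i).2.1 _ (List.mem_map.2 ⟨x, List.mem_append_left _ hx, rfl⟩)
  have hmc : ∀ i, InCell a (m i) c.1 c.2.1 := fun i =>
    ⟨fun x hx => (hm i).2.1 _ (List.mem_map.2 ⟨x, List.mem_append_right _ hx, rfl⟩),
      prod_map_notMem_iff.1 (hm i).2.2⟩
  have hcard : ∀ i, ENat.card (R ⧸ (m i).asIdeal) = (σ.1 ^ k i : ℕ) := fun i => by
    have hfin : Finite (R ⧸ (m i).asIdeal) :=
      Nat.finite_of_card_ne_zero (by rw [(hm i).1]; exact (pow_pos hp.pos _).ne')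
    rw [ENat.card_eq_coe_natCard, (hm i).1]
  refine ⟨l.map m, ?_, fun i hi => ?_⟩
  · intro x hx
    obtain ⟨i, -, rfl⟩ := List.mem_map.1 hx
    exact hmP i
  · rw [List.map_map]
    have : ((fun m => (PairCode.toPair a (σ.constraints τ)[i].1).invariant (N m)) ∘ m) =
        fun j => powExp ((σ.1 ^ k j : ℕ) : ℕ∞) (c.2.2.getD i (0, 0)) := by
      funext j
      rw [Function.comp_apply, hcells.cellProd_value (hmP j) _ hc (hmc j) i hi, hcard]
    rw [this, prod_powExp_pow hp.ne_zero k hk]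
    congr 1
    exact (List.getD_map _ (0, 0)
      fun e : ℕ × ℕ => ((l.map k).sum * e.1, (l.map k).sum * e.2)).symm

theorem InvariantsInput.holds_iff (τ : PairCode) (σ : InvariantsInput) (M : Type u)
    [AddCommGroup M] [Module R M] : σ.Holds a (PairCode.toPair a τ) M ↔
      ∀ κ ∈ σ.constraints τ, MeetsInvariant σ.1 κ.2 ((PairCode.toPair a κ.1).invariant M) := by
  obtain ⟨p, w, E, U, G⟩ := σ
  simp only [InvariantsInput.Holds, InvariantsInput.constraints, List.mem_cons, List.mem_append,
    List.mem_map, or_imp, forall_and, forall_eq, forall_exists_index, and_imp,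
    forall_apply_eq_imp_iff₂, MeetsInvariant, cond_true, cond_false, pow_zero, Nat.cast_one]

theorem exists_finiteSum_holds_iff :
    (∃ (M : Type u) (_ : AddCommGroup M) (_ : Module R M),
      IsFiniteSumOf N P M ∧ σ.Holds a (PairCode.toPair a τ) M) ↔
    ∃ ms : List (MaximalSpectrum R), ms ≠ [] ∧ (∀ m ∈ ms, m ∈ P) ∧
      ∀ κ ∈ σ.constraints τ, MeetsInvariant σ.1 κ.2
        (ms.map fun m => (PairCode.toPair a κ.1).invariant (N m)).prod := by
  constructor
  · rintro ⟨M, _, _, ⟨k, hk, m, hm, ⟨e⟩⟩, hM⟩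
    refine ⟨List.ofFn m, ?_, ?_, fun κ hκ => ?_⟩
    · rw [Ne, List.ofFn_eq_nil_iff]
      exact hk.ne'
    · intro x hx
      obtain ⟨i, rfl⟩ := (List.mem_ofFn' m x).1 hx
      exact hm i
    · have := (InvariantsInput.holds_iff τ σ M).1 hM κ hκ
      rw [PPPair.invariant_congr e, PPPair.invariant_directSum] at this
      rwa [List.map_ofFn, List.prod_ofFn]
  · rintro ⟨ms, hne, hms, h⟩
    refine ⟨⨁ i : Fin ms.length, N (ms.get i), inferInstance, inferInstance,
      ⟨ms.length, List.length_pos_of_ne_nil hne, ms.get, fun i => hms _ (List.get_mem _ _),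
        ⟨LinearEquiv.refl _ _⟩⟩, (InvariantsInput.holds_iff τ σ _).2 fun κ hκ => ?_⟩
    have := h κ hκ
    rw [PPPair.invariant_directSum]
    rwa [← List.ofFn_get ms, List.map_ofFn, List.prod_ofFn] at this

theorem hasAlgorithm_of_isCellDecomposition (ha : IsEffectiveListing a) (hPP : PPStarRecursive a)
    (hc : Computable cells) (hcells : IsCellDecomposition a N P cells) (hC₀ : C₀ ≠ [])
    (hP : ∀ m, m ∈ P ↔ ∀ c ∈ C₀, a c ∈ m.asIdeal)
    (hτ : ∀ m ∈ P, (PairCode.toPair a τ).invariant (N m) = ENat.card (R ⧸ m.asIdeal)) :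
    HasAlgorithm InvariantsInput.Valid fun σ =>
      ∃ (M : Type u) (_ : AddCommGroup M) (_ : Module R M),
        IsFiniteSumOf N P M ∧ σ.Holds a (PairCode.toPair a τ) M := by
  obtain ⟨test, htc, ht⟩ := exists_decidesPPStar ha hPP C₀
  refine ⟨_, computable_decideInput htc hc τ, fun σ hσ => ?_⟩
  have hp : σ.1.Prime := hσ.1
  have hw : 0 < σ.2.1 := hσ.2.1
  refine decideInput_eq_true_iff.trans (Iff.trans ?_ exists_finiteSum_holds_iff.symm)
  have hτmem : (τ, true, σ.2.1) ∈ σ.constraints τ := List.mem_cons_self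
  constructor
  · rintro ⟨l, -, hl, hmeets⟩
    choose! ms hms hprod using fun v (hv : v ∈ inputSteps test cells τ σ) =>
      exists_list_of_mem_inputSteps (τ := τ) hcells hP ht hv
    have hmeet : ∀ κ ∈ σ.constraints τ, MeetsInvariant σ.1 κ.2
        ((l.flatMap ms).map fun m => (PairCode.toPair a κ.1).invariant (N m)).prod := by
      intro κ hκ
      obtain ⟨i, hi, rfl⟩ := List.mem_iff_getElem.1 hκ
      have h := (meets_iff hp.two_le _ _).1 (hmeets i hi)
      rw [powExp_list_sum hp.ne_zero] at h
      convert h using 1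
      clear h hmeets
      induction l with
      | nil => rfl
      | cons v l ih =>
        rw [List.flatMap_cons, List.map_append, List.prod_append, List.map_cons, List.prod_cons,
          ih fun v hv => hl v (List.mem_cons_of_mem _ hv), hprod v (hl v List.mem_cons_self) i hi]
    refine ⟨l.flatMap ms, fun hnil => ?_, fun m hm => ?_, hmeet⟩
    · have h := hmeet _ hτmem
      rw [hnil] at h
      have h' : (1 : ℕ∞) = (σ.1 ^ σ.2.1 : ℕ) := h
      exact (Nat.one_lt_pow hw.ne' hp.one_lt).ne (by exact_mod_cast h')
    · obtain ⟨v, hv, hmv⟩ := List.mem_flatMap.1 hm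
      exact hms v (hl v hv) m hmv
  · rintro ⟨ms, -, hms, hmeets⟩
    have hprod : (ms.map fun m => ENat.card (R ⧸ m.asIdeal)).prod = (σ.1 ^ σ.2.1 : ℕ) := by
      have h := hmeets _ hτmem
      rwa [List.map_congr_left fun m hm => hτ m (hms m hm)] at h
    obtain ⟨hlen, hpow⟩ := exists_pow_of_list_prod_eq hp _ ms (fun m _ => by
      have : Nontrivial (R ⧸ m.asIdeal) := Ideal.Quotient.nontrivial_iff.2 m.isMaximal.ne_top
      exact ENat.one_lt_card) hprod
    choose! v hv hvi using fun m (hm : m ∈ ms) =>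
      let ⟨k, hk, hkw, hcard⟩ := hpow m hm
      exists_inputStep (τ := τ) hcells hC₀ hP ht hp (hms m hm) hk hkw hcard
    refine ⟨ms.map v, by simpa using hlen, ?_, fun i hi => ?_⟩
    · intro x hx
      obtain ⟨m, hm, rfl⟩ := List.mem_map.1 hx
      exact hv m hm
    · rw [meets_iff hp.two_le, powExp_list_sum hp.ne_zero, List.map_map]
      have h := hmeets _ (List.getElem_mem hi)
      rwa [List.map_congr_left fun m hm => hvi m hm i hi] at h

end Correctness

section DenseValuationRing

/-- Every nonzero nonunit is a product of two nonunits. -/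
def NonunitsSplit (V : Type*) [CommRing V] : Prop :=
  ∀ e : V, e ≠ 0 → ¬IsUnit e → ∃ y z, ¬IsUnit y ∧ ¬IsUnit z ∧ e = y * z

theorem HasDenseValueGroup.nonunitsSplit {V : Type u} [CommRing V] [IsDomain V] [ValuationRing V]
    (h : HasDenseValueGroup V) : NonunitsSplit V := by
  intro e he hu
  have := h
  let K := FractionRing V
  let v := ValuationRing.valuation V K
  have hle : ∀ x : V, v (algebraMap V K x) ≤ 1 := fun x =>
    (ValuationRing.mem_integer_iff V K _).2 ⟨x, rfl⟩
  have hlift : ∀ k : K, v k ≤ 1 → ∃ x : V, algebraMap V K x = k := fun k hk =>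
    (ValuationRing.mem_integer_iff V K k).1 hk
  have hne : ∀ x : V, x ≠ 0 → algebraMap V K x ≠ 0 := fun x hx =>
    (map_ne_zero_iff _ (IsFractionRing.injective V K)).2 hx
  have hunit : ∀ x : V, x ≠ 0 → (v (algebraMap V K x) < 1 ↔ ¬IsUnit x) := by
    intro x hx
    rw [lt_iff_le_and_ne, and_iff_right (hle x), not_iff_not]
    constructor
    · intro h1
      obtain ⟨y, hy⟩ := hlift (algebraMap V K x)⁻¹ (by rw [map_inv₀, h1, inv_one])
      refine IsUnit.of_mul_eq_one y (IsFractionRing.injective V K ?_)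
      rw [map_mul, hy, mul_inv_cancel₀ (hne x hx), map_one]
    · intro h1
      obtain ⟨u, rfl⟩ := h1
      refine le_antisymm (hle _) ?_
      have h2 : v (algebraMap V K u) * v (algebraMap V K (u⁻¹ : Vˣ)) = 1 := by
        rw [← map_mul, ← map_mul, Units.mul_inv, map_one, map_one]
      calc (1 : ValuationRing.ValueGroup V K) = _ := h2.symm
        _ ≤ v (algebraMap V K u) * 1 := mul_le_mul_right (hle _) _
        _ = _ := mul_one _
  have hve : v (algebraMap V K e) ≠ 0 := (Valuation.ne_zero_iff v).2 (hne e he)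
  obtain ⟨g, hg1, hg2⟩ := h.dense (Units.mk0 _ hve) 1
    (by rw [← Units.val_lt_val]; exact (hunit e he).2 hu)
  obtain ⟨k, hk⟩ : ∃ k : K, v k = (g : ValuationRing.ValueGroup V K) := by
    obtain ⟨k, hk⟩ := Quotient.exists_rep (g : ValuationRing.ValueGroup V K)
    exact ⟨k, hk⟩
  rw [← Units.val_lt_val] at hg1 hg2
  rw [← hk] at hg1 hg2
  change v (algebraMap V K e) < v k at hg1
  change v k < 1 at hg2
  have hk0 : k ≠ 0 := fun h0 => by rw [h0, map_zero] at hg1; exact not_lt_zero hg1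
  obtain ⟨y, rfl⟩ := hlift k hg2.le
  have hquot : v (algebraMap V K e / algebraMap V K y) < 1 := by
    rw [map_div₀, div_lt_one₀ (zero_lt_iff.2 ((Valuation.ne_zero_iff v).2 hk0))]
    exact hg1
  obtain ⟨z, hz⟩ := hlift _ hquot.le
  have hy0 : y ≠ 0 := fun h0 => hk0 (by rw [h0, map_zero])
  have hez : e = y * z := IsFractionRing.injective V K (by
    rw [map_mul, hz, mul_div_cancel₀ _ hk0])
  have hz0 : z ≠ 0 := fun h0 => he (by rw [hez, h0, mul_zero])
  refine ⟨y, z, (hunit y hy0).1 hg2, (hunit z hz0).1 (by rw [hz]; exact hquot), hez⟩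

variable {V : Type u} [CommRing V] [IsDomain V] [ValuationRing V]

theorem NonunitsSplit.exists_seq (hd : NonunitsSplit V) {e : V} (he : e ≠ 0) (hu : ¬IsUnit e) :
    ∃ y : ℕ → V, (∀ i, ¬IsUnit (y i)) ∧
      ∀ i j, i < j → ¬IsUnit (y i - y j) ∧ ¬e ∣ y i - y j := by
  have hstep : ∀ x : {x : V // x ≠ 0 ∧ ¬IsUnit x}, ∃ y : {x : V // x ≠ 0 ∧ ¬IsUnit x},
      ∃ z, ¬IsUnit z ∧ x.1 = y.1 * z := by
    rintro ⟨x, hx0, hxu⟩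
    obtain ⟨y, z, hy, hz, rfl⟩ := hd x hx0 hxu
    exact ⟨⟨y, left_ne_zero_of_mul hx0, hy⟩, z, hz, rfl⟩
  choose f hf using hstep
  let y : ℕ → {x : V // x ≠ 0 ∧ ¬IsUnit x} := fun n => f^[n] (f ⟨e, he, hu⟩)
  have hsucc : ∀ i, ∃ z, ¬IsUnit z ∧ (y i).1 = (y (i + 1)).1 * z := fun i => by
    have : y (i + 1) = f (y i) := Function.iterate_succ_apply' f i _
    rw [this]
    exact hf (y i)
  have hlt : ∀ i j, i < j → ∃ z, ¬IsUnit z ∧ (y i).1 = (y j).1 * z := by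
    intro i j hij
    induction j, hij using Nat.le_induction with
    | base => exact hsucc i
    | succ j _ ih =>
      obtain ⟨z, hz, h⟩ := ih
      obtain ⟨z', _, h'⟩ := hsucc j
      exact ⟨z' * z, fun h => hz (isUnit_of_mul_isUnit_right h), by rw [h, h', mul_assoc]⟩
  have he' : ∀ j, ∃ z, ¬IsUnit z ∧ e = (y j).1 * z := by
    intro j
    obtain ⟨z, hz, h⟩ := hf ⟨e, he, hu⟩
    rcases Nat.eq_zero_or_pos j with rfl | hj
    · exact ⟨z, hz, h⟩
    · obtain ⟨z', _, h'⟩ := hlt 0 j hj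
      refine ⟨z' * z, fun h => hz (isUnit_of_mul_isUnit_right h), ?_⟩
      rw [← mul_assoc, ← h']
      exact h
  refine ⟨fun i => (y i).1, fun i => (y i).2.2, fun i j hij => ?_⟩
  obtain ⟨z, hz, h⟩ := hlt i j hij
  have hsub : (y i).1 - (y j).1 = (y j).1 * (z - 1) := by rw [h]; ring
  have hzu : IsUnit (z - 1) := by
    have h1 := ((IsLocalRing.isUnit_or_isUnit_one_sub_self z).resolve_left hz).neg
    rwa [neg_sub] at h1
  refine ⟨?_, ?_⟩
  · rw [hsub]
    exact fun h => (y j).2.2 (isUnit_of_mul_isUnit_left h)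
  · rw [hsub]
    intro hdvd
    obtain ⟨n, hn, hen⟩ := he' j
    rw [hen] at hdvd
    exact hn (isUnit_of_dvd_unit ((mul_dvd_mul_iff_left (y j).2.1).1 hdvd) hzu)

theorem eq_zero_of_eq_mul_add {x n n' : V} (hn : ¬IsUnit n) (hn' : ¬IsUnit n')
    (h : x = x * n + x * n') : x = 0 := by
  have hsum : ¬IsUnit (n + n') := IsLocalRing.nonunits_add hn hn'
  by_contra hx
  rw [← mul_add] at h
  have h1 : n + n' = 1 := mul_left_cancel₀ hx (by rw [mul_one, ← h])
  exact hsum (h1 ▸ isUnit_one)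

theorem exists_nonunit_mul_of_not_dvd {x y : V} (h : ¬x ∣ y) : ∃ n, ¬IsUnit n ∧ x = y * n := by
  obtain ⟨n, hn⟩ := (ValuationRing.dvd_total x y).resolve_left h
  refine ⟨n, fun hu => h ?_, hn⟩
  rw [hn]
  exact (hu.mul_right_dvd).2 dvd_rfl

/-- If `b` and `c` are nonunits and `b ≠ 0`, then some nonzero nonunit divides both and is
associated to one of them. -/
theorem exists_common_bound {b c : V} (hb0 : b ≠ 0) (hb : ¬IsUnit b) (hc : ¬IsUnit c) :
    ∃ e, e ≠ 0 ∧ ¬IsUnit e ∧ ∀ z, ¬e ∣ z → ¬b ∣ z ∧ ¬c ∣ z ∧ z ∣ b ∧ z ∣ c := by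
  by_cases h : b ∣ c
  · refine ⟨b, hb0, hb, fun z hz => ?_⟩
    have hzb := (ValuationRing.dvd_total b z).resolve_left hz
    exact ⟨hz, fun hc => hz (h.trans hc), hzb, hzb.trans h⟩
  · have h' := (ValuationRing.dvd_total b c).resolve_left h
    refine ⟨c, fun h0 => h (h0 ▸ dvd_zero b), hc, fun z hz => ?_⟩
    have hzc := (ValuationRing.dvd_total c z).resolve_left hz
    exact ⟨fun hb => hz (h'.trans hb), hz, hzc.trans h', hzc⟩

end DenseValuationRing

section LocalInvariants

namespace PPPair

variable {R V : Type u} [CommRing R] [CommRing V] [Algebra R V] {I J K : Ideal V} {γ δ : R}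

theorem smul_mk_quotient (r : R) (x : V) :
    r • (Submodule.Quotient.mk x : V ⧸ J) = Submodule.Quotient.mk (algebraMap R V r * x) := by
  rw [← Algebra.smul_def]
  rfl

theorem smul_mk_quotient_eq_zero_iff (hJ : ∀ x, x ∈ J ↔ ¬x ∣ algebraMap R V γ)
    (r : R) (x : V) :
    r • (Submodule.Quotient.mk x : V ⧸ J) = 0 ↔ ¬algebraMap R V r * x ∣ algebraMap R V γ := by
  rw [smul_mk_quotient, Submodule.Quotient.mk_eq_zero, hJ]

theorem smul_mk_idealQuotient (r : R) (x : I) :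
    r • (Submodule.Quotient.mk x : I ⧸ Submodule.submoduleOf K I) =
      Submodule.Quotient.mk ⟨algebraMap R V r * x, I.mul_mem_left _ x.2⟩ := by
  rw [← Submodule.Quotient.mk_smul]
  congr 1
  exact Subtype.ext (Algebra.smul_def r (x : V))

theorem mk_idealQuotient_eq_zero_iff (hK : ∀ x, x ∈ K ↔ algebraMap R V δ ∣ x) (x : I) :
    (Submodule.Quotient.mk x : I ⧸ Submodule.submoduleOf K I) = 0 ↔
      algebraMap R V δ ∣ (x : V) := by
  rw [Submodule.Quotient.mk_eq_zero, ← hK]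
  rfl

theorem smul_mk_idealQuotient_eq_zero_iff (hK : ∀ x, x ∈ K ↔ algebraMap R V δ ∣ x) (r : R)
    (x : I) : r • (Submodule.Quotient.mk x : I ⧸ Submodule.submoduleOf K I) = 0 ↔
      algebraMap R V δ ∣ algebraMap R V r * x := by
  rw [smul_mk_idealQuotient, mk_idealQuotient_eq_zero_iff hK]

theorem invariant_topAnn_quotient_eq_one (hJ : ∀ x, x ∈ J ↔ ¬x ∣ algebraMap R V γ) {d : R}
    (h : ¬algebraMap R V d ∣ algebraMap R V γ) : (topAnn d).invariant (V ⧸ J) = 1 := by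
  refine invariant_eq_one_of_le fun x _ => ?_
  obtain ⟨x, rfl⟩ := Submodule.Quotient.mk_surjective _ x
  rw [mem_lower_topAnn, smul_mk_quotient_eq_zero_iff hJ]
  exact fun h' => h (dvd_of_mul_right_dvd h')

theorem invariant_topAnn_idealQuotient_eq_one (hK : ∀ x, x ∈ K ↔ algebraMap R V δ ∣ x) {d : R}
    (h : algebraMap R V δ ∣ algebraMap R V d) :
    (topAnn d).invariant (I ⧸ Submodule.submoduleOf K I) = 1 := by
  refine invariant_eq_one_of_le fun x _ => ?_
  obtain ⟨x, rfl⟩ := Submodule.Quotient.mk_surjective _ x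
  rw [mem_lower_topAnn, smul_mk_idealQuotient_eq_zero_iff hK]
  exact h.mul_right _

variable [IsDomain V] [ValuationRing V]

theorem invariant_eq_card_residue {M : Type u} [AddCommGroup M] [Module R M] {π : PPPair R}
    (g : V →ₗ[R] M) (hupper : ∀ v, g v ∈ π.upper M)
    (hsurj : ∀ x ∈ π.upper M, ∃ v, x - g v ∈ π.lower M)
    (hlower : ∀ v, g v ∈ π.lower M ↔ ¬IsUnit v) :
    π.invariant M = ENat.card (V ⧸ IsLocalRing.maximalIdeal V) := by
  rw [invariant_eq_card_quotient ((IsLocalRing.maximalIdeal V).restrictScalars R) g hupper hsurj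
    fun v => (hlower v).trans (IsLocalRing.mem_maximalIdeal v).symm]
  exact ENat.card_congr (Submodule.Quotient.restrictScalarsEquiv R
    (IsLocalRing.maximalIdeal V)).toEquiv

section Quotient

/-! The invariants of `V ⧸ γ 𝔪`. -/

theorem mem_lower_annDvd_quotient (hJ : ∀ x, x ∈ J ↔ ¬x ∣ algebraMap R V γ)
    (hγ : algebraMap R V γ ≠ 0) (b c : R) (x : V) :
    (Submodule.Quotient.mk x : V ⧸ J) ∈ (annDvd b c).lower (V ⧸ J) ↔
      algebraMap R V c ∣ x ∨ ¬x ∣ algebraMap R V γ := by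
  rw [mem_lower_annDvd]
  constructor
  · rintro ⟨y, hy⟩
    obtain ⟨y, rfl⟩ := Submodule.Quotient.mk_surjective _ y
    rw [smul_mk_quotient, eq_comm, Submodule.Quotient.eq, hJ] at hy
    by_contra! hcon
    obtain ⟨hcx, hxγ⟩ := hcon
    obtain ⟨n, hn, h⟩ := exists_nonunit_mul_of_not_dvd hy
    obtain ⟨n', hn', h'⟩ := exists_nonunit_mul_of_not_dvd hcx
    obtain ⟨t, ht⟩ := hxγ
    have hx : x = 0 := by
      refine eq_zero_of_eq_mul_add (n := t * n) (n' := n' * y)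
        (fun h => hn (isUnit_of_mul_isUnit_right h)) (fun h => hn' (isUnit_of_mul_isUnit_left h)) ?_
      calc x = (x - algebraMap R V c * y) + algebraMap R V c * y := by ring
        _ = x * (t * n) + x * (n' * y) := by rw [h, h', ht]; ring
    exact hγ (by rw [ht, hx, zero_mul])
  · rintro (⟨y, rfl⟩ | h)
    · exact ⟨Submodule.Quotient.mk y, smul_mk_quotient c y⟩
    · refine ⟨0, ?_⟩
      rw [smul_zero, eq_comm, Submodule.Quotient.mk_eq_zero, hJ]
      exact h

theorem invariant_quotient_eq_top {π : PPPair R} (hd : NonunitsSplit V) {e : V} (he : e ≠ 0)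
    (hu : ¬IsUnit e) (f : V)
    (hupper : ∀ y, ¬IsUnit y → (Submodule.Quotient.mk (f * y) : V ⧸ J) ∈ π.upper (V ⧸ J))
    (hlower : ∀ z, ¬e ∣ z → (Submodule.Quotient.mk (f * z) : V ⧸ J) ∉ π.lower (V ⧸ J)) :
    π.invariant (V ⧸ J) = ⊤ := by
  obtain ⟨y, hy, hsub⟩ := hd.exists_seq he hu
  refine invariant_eq_top_of_seq (fun i => Submodule.Quotient.mk (f * y i))
    (fun i => hupper _ (hy i)) fun i j hij => ?_
  rw [← Submodule.Quotient.mk_sub, ← mul_sub]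
  exact hlower _ (hsub i j hij).2

theorem invariant_topAnn_quotient_eq_card (hJ : ∀ x, x ∈ J ↔ ¬x ∣ algebraMap R V γ)
    (hγ : algebraMap R V γ ≠ 0) {d : R} (h : algebraMap R V d ∣ algebraMap R V γ)
    (h' : algebraMap R V γ ∣ algebraMap R V d) :
    (topAnn d).invariant (V ⧸ J) = ENat.card (V ⧸ IsLocalRing.maximalIdeal V) := by
  refine invariant_eq_card_residue (J.mkQ.restrictScalars R) (fun v => by simp) (fun x _ => ?_)
    fun v => ?_
  · obtain ⟨x, rfl⟩ := Submodule.Quotient.mk_surjective _ x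
    exact ⟨x, by simp⟩
  · change Submodule.Quotient.mk v ∈ _ ↔ _
    rw [mem_lower_topAnn, smul_mk_quotient_eq_zero_iff hJ, not_iff_not]
    refine ⟨fun hv => ?_, fun hv => (hv.mul_right_dvd).2 h⟩
    have hd : algebraMap R V d ≠ 0 := fun h0 => hγ (zero_dvd_iff.1 (h0 ▸ h))
    refine isUnit_of_dvd_one ((mul_dvd_mul_iff_left hd).1 ?_)
    rw [mul_one]
    exact hv.trans h'

theorem invariant_topAnn_quotient_eq_top (hJ : ∀ x, x ∈ J ↔ ¬x ∣ algebraMap R V γ)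
    (hd : NonunitsSplit V) (hγ : algebraMap R V γ ≠ 0) {d : R}
    (h : ¬algebraMap R V γ ∣ algebraMap R V d) :
    (topAnn d).invariant (V ⧸ J) = ⊤ := by
  obtain ⟨e, hu, he⟩ := exists_nonunit_mul_of_not_dvd h
  have he0 : e ≠ 0 := fun h0 => hγ (by rw [he, h0, mul_zero])
  refine invariant_quotient_eq_top hd he0 hu 1 (fun y _ => by simp) fun z hz => ?_
  rw [mem_lower_topAnn, smul_mk_quotient_eq_zero_iff hJ, not_not, one_mul, he]
  exact mul_dvd_mul_left _ ((ValuationRing.dvd_total e z).resolve_left hz)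

theorem invariant_annDvd_quotient_eq_one_of_isUnit (hJ : ∀ x, x ∈ J ↔ ¬x ∣ algebraMap R V γ)
    (hγ : algebraMap R V γ ≠ 0) {b c : R} (hc : IsUnit (algebraMap R V c)) :
    (annDvd b c).invariant (V ⧸ J) = 1 := by
  refine invariant_eq_one_of_le fun x _ => ?_
  obtain ⟨x, rfl⟩ := Submodule.Quotient.mk_surjective _ x
  exact (mem_lower_annDvd_quotient hJ hγ b c x).2 (Or.inl hc.dvd)

theorem invariant_annDvd_quotient_eq_one_of_dvd (hJ : ∀ x, x ∈ J ↔ ¬x ∣ algebraMap R V γ)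
    (hγ : algebraMap R V γ ≠ 0) {b c : R}
    (h : algebraMap R V (c * b) ∣ algebraMap R V γ) : (annDvd b c).invariant (V ⧸ J) = 1 := by
  refine invariant_eq_one_of_le fun x hx => ?_
  obtain ⟨x, rfl⟩ := Submodule.Quotient.mk_surjective _ x
  rw [mem_upper_annDvd, smul_mk_quotient_eq_zero_iff hJ] at hx
  refine (mem_lower_annDvd_quotient hJ hγ b c x).2 (Or.inl ?_)
  refine (ValuationRing.dvd_total _ _).resolve_right fun hxc => hx ?_
  refine dvd_trans ?_ h
  rw [map_mul, mul_comm]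
  exact mul_dvd_mul_right hxc _

theorem invariant_annDvd_quotient_eq_one_of_isUnit_left
    (hJ : ∀ x, x ∈ J ↔ ¬x ∣ algebraMap R V γ) (hγ : algebraMap R V γ ≠ 0) {b c : R}
    (hb : IsUnit (algebraMap R V b)) : (annDvd b c).invariant (V ⧸ J) = 1 := by
  refine invariant_eq_one_of_le fun x hx => ?_
  obtain ⟨x, rfl⟩ := Submodule.Quotient.mk_surjective _ x
  rw [mem_upper_annDvd, smul_mk_quotient_eq_zero_iff hJ] at hx
  exact (mem_lower_annDvd_quotient hJ hγ b c x).2 (Or.inr fun h => hx ((hb.mul_left_dvd).2 h))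

theorem invariant_annDvd_quotient_eq_top (hJ : ∀ x, x ∈ J ↔ ¬x ∣ algebraMap R V γ)
    (hd : NonunitsSplit V) (hγ : algebraMap R V γ ≠ 0) {b c : R}
    (hb : algebraMap R V b ∣ algebraMap R V γ) (hbu : ¬IsUnit (algebraMap R V b))
    (h : ¬algebraMap R V (c * b) ∣ algebraMap R V γ) :
    (annDvd b c).invariant (V ⧸ J) = ⊤ := by
  obtain ⟨f, hf⟩ := hb
  have hb0 : algebraMap R V b ≠ 0 := fun h0 => hγ (by rw [hf, h0, zero_mul])
  have hf0 : f ≠ 0 := fun h0 => hγ (by rw [hf, h0, mul_zero])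
  have hcf : ¬algebraMap R V c ∣ f := fun h' => h (by
    rw [map_mul, hf, mul_comm]
    exact mul_dvd_mul_left _ h')
  obtain ⟨c', hc', hc⟩ := exists_nonunit_mul_of_not_dvd hcf
  obtain ⟨e, he0, heu, he⟩ := exists_common_bound hb0 hbu hc'
  refine invariant_quotient_eq_top hd he0 heu f (fun y hy => ?_) fun z hz => ?_
  · rw [mem_upper_annDvd, smul_mk_quotient_eq_zero_iff hJ, ← mul_assoc, ← hf]
    intro h'
    refine hy (isUnit_of_dvd_one ((mul_dvd_mul_iff_left hγ).1 ?_))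
    rwa [mul_one]
  · obtain ⟨-, h2, h3, -⟩ := he z hz
    rw [mem_lower_annDvd_quotient hJ hγ, not_or, not_not, hc, mul_dvd_mul_iff_left hf0]
    refine ⟨h2, ?_⟩
    rw [hf, mul_comm _ f]
    exact mul_dvd_mul_left f h3

theorem invariant_annDvd_quotient_eq_top_of_not_dvd (hJ : ∀ x, x ∈ J ↔ ¬x ∣ algebraMap R V γ)
    (hd : NonunitsSplit V) (hγ : algebraMap R V γ ≠ 0) {b c : R}
    (hb : ¬algebraMap R V b ∣ algebraMap R V γ) (hc : ¬IsUnit (algebraMap R V c))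
    (h : algebraMap R V c ∣ algebraMap R V γ ∨ ¬IsUnit (algebraMap R V γ)) :
    (annDvd b c).invariant (V ⧸ J) = ⊤ := by
  have hupper : ∀ y : V, (Submodule.Quotient.mk y : V ⧸ J) ∈ (annDvd b c).upper (V ⧸ J) := by
    intro y
    rw [mem_upper_annDvd, smul_mk_quotient_eq_zero_iff hJ]
    exact fun h' => hb (dvd_of_mul_right_dvd h')
  by_cases hcγ : algebraMap R V c ∣ algebraMap R V γ
  · have hc0 : algebraMap R V c ≠ 0 := fun h0 => hγ (zero_dvd_iff.1 (h0 ▸ hcγ))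
    refine invariant_quotient_eq_top hd hc0 hc 1 (fun y _ => hupper _) fun z hz => ?_
    rw [mem_lower_annDvd_quotient hJ hγ, not_or, not_not, one_mul]
    exact ⟨hz, ((ValuationRing.dvd_total _ z).resolve_left hz).trans hcγ⟩
  · refine invariant_quotient_eq_top hd hγ (h.resolve_left hcγ) 1 (fun y _ => hupper _)
      fun z hz => ?_
    rw [mem_lower_annDvd_quotient hJ hγ, not_or, not_not, one_mul]
    exact ⟨fun h' => hz (((ValuationRing.dvd_total _ _).resolve_left hcγ).trans h'),
      (ValuationRing.dvd_total _ z).resolve_left hz⟩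

theorem invariant_annDvd_quotient_eq_card (hJ : ∀ x, x ∈ J ↔ ¬x ∣ algebraMap R V γ)
    (hγ : algebraMap R V γ ≠ 0) {b c : R} (hb : ¬algebraMap R V b ∣ algebraMap R V γ)
    (hc : ¬IsUnit (algebraMap R V c)) (hγu : IsUnit (algebraMap R V γ)) :
    (annDvd b c).invariant (V ⧸ J) = ENat.card (V ⧸ IsLocalRing.maximalIdeal V) := by
  refine invariant_eq_card_residue (J.mkQ.restrictScalars R) (fun v => ?_) (fun x _ => ?_)
    fun v => ?_
  · change Submodule.Quotient.mk v ∈ _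
    rw [mem_upper_annDvd, smul_mk_quotient_eq_zero_iff hJ]
    exact fun h' => hb (dvd_of_mul_right_dvd h')
  · obtain ⟨x, rfl⟩ := Submodule.Quotient.mk_surjective _ x
    exact ⟨x, by simp⟩
  · change Submodule.Quotient.mk v ∈ _ ↔ _
    rw [mem_lower_annDvd_quotient hJ hγ]
    constructor
    · rintro (h | h) hv
      · exact hc (isUnit_of_dvd_unit h hv)
      · exact h hv.dvd
    · exact fun hv => Or.inr fun h => hv (isUnit_of_dvd_unit h hγu)

end Quotient

section IdealQuotient

/-! The invariants of `𝔪 ⧸ δ V`. -/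

theorem mem_lower_annDvd_idealQuotient (hI : ∀ x, x ∈ I ↔ ¬IsUnit x)
    (hK : ∀ x, x ∈ K ↔ algebraMap R V δ ∣ x) (b c : R) (x : I) :
    (Submodule.Quotient.mk x : I ⧸ Submodule.submoduleOf K I) ∈
        (annDvd b c).lower (I ⧸ Submodule.submoduleOf K I) ↔
      algebraMap R V δ ∣ (x : V) ∨ ¬(x : V) ∣ algebraMap R V c := by
  rw [mem_lower_annDvd]
  constructor
  · rintro ⟨y, hy⟩
    obtain ⟨y, rfl⟩ := Submodule.Quotient.mk_surjective _ y
    rw [smul_mk_idealQuotient, eq_comm, ← sub_eq_zero, ← Submodule.Quotient.mk_sub,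
      mk_idealQuotient_eq_zero_iff hK] at hy
    by_contra! hcon
    obtain ⟨hδx, t, ht⟩ := hcon
    obtain ⟨n, hn, h⟩ := exists_nonunit_mul_of_not_dvd hδx
    obtain ⟨s, hs⟩ := hy
    rw [Submodule.coe_sub] at hs
    have hx : (x : V) = 0 := by
      refine eq_zero_of_eq_mul_add (n := n * s) (n' := t * y)
        (fun h => hn (isUnit_of_mul_isUnit_left h))
        (fun h => (hI y).1 y.2 (isUnit_of_mul_isUnit_right h)) ?_
      calc (x : V) = (x - algebraMap R V c * y) + algebraMap R V c * y := by ring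
        _ = x * (n * s) + x * (t * y) := by rw [hs, h, ht]; ring
    exact hδx (hx ▸ dvd_zero _)
  · rintro (h | h)
    · exact ⟨0, by rw [smul_zero, eq_comm, mk_idealQuotient_eq_zero_iff hK]; exact h⟩
    · obtain ⟨n, hn, hx⟩ := exists_nonunit_mul_of_not_dvd h
      refine ⟨Submodule.Quotient.mk ⟨n, (hI n).2 hn⟩, ?_⟩
      rw [smul_mk_idealQuotient]
      congr 1
      exact Subtype.ext hx.symm

theorem invariant_idealQuotient_eq_top (hI : ∀ x, x ∈ I ↔ ¬IsUnit x) {π : PPPair R}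
    (hd : NonunitsSplit V) {e : V} (he : e ≠ 0) (hu : ¬IsUnit e) (f : V)
    (hupper : ∀ (y : V) (hy : f * y ∈ I), (Submodule.Quotient.mk ⟨f * y, hy⟩ :
      I ⧸ Submodule.submoduleOf K I) ∈ π.upper (I ⧸ Submodule.submoduleOf K I))
    (hlower : ∀ (z : V) (hz : f * z ∈ I), ¬e ∣ z → (Submodule.Quotient.mk ⟨f * z, hz⟩ :
      I ⧸ Submodule.submoduleOf K I) ∉ π.lower (I ⧸ Submodule.submoduleOf K I)) :
    π.invariant (I ⧸ Submodule.submoduleOf K I) = ⊤ := by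
  obtain ⟨y, hy, hsub⟩ := hd.exists_seq he hu
  have hmem : ∀ z, ¬IsUnit z → f * z ∈ I := fun z hz =>
    (hI _).2 fun h => hz (isUnit_of_mul_isUnit_right h)
  refine invariant_eq_top_of_seq (fun i => Submodule.Quotient.mk ⟨f * y i, hmem _ (hy i)⟩)
    (fun i => hupper _ _) fun i j hij => ?_
  have h := hlower (y i - y j) (hmem _ (hsub i j hij).1) (hsub i j hij).2
  rw [← Submodule.Quotient.mk_sub]
  convert h using 3
  exact Subtype.ext (mul_sub _ _ _).symm

theorem invariant_topAnn_idealQuotient_eq_top (hI : ∀ x, x ∈ I ↔ ¬IsUnit x)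
    (hK : ∀ x, x ∈ K ↔ algebraMap R V δ ∣ x) (hd : NonunitsSplit V) (hδ : algebraMap R V δ ≠ 0)
    {d : R} (h : ¬algebraMap R V δ ∣ algebraMap R V d) :
    (topAnn d).invariant (I ⧸ Submodule.submoduleOf K I) = ⊤ := by
  obtain ⟨e, hu, he⟩ := exists_nonunit_mul_of_not_dvd h
  have hd0 : algebraMap R V d ≠ 0 := fun h0 => hδ (by rw [he, h0, zero_mul])
  have he0 : e ≠ 0 := fun h0 => hδ (by rw [he, h0, mul_zero])
  refine invariant_idealQuotient_eq_top hI hd he0 hu 1 (fun y _ => by simp) fun z _ hz => ?_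
  rw [mem_lower_topAnn, smul_mk_idealQuotient_eq_zero_iff hK, he]
  simpa only [one_mul, mul_dvd_mul_iff_left hd0] using hz

theorem invariant_annDvd_idealQuotient_eq_one_of_isUnit (hI : ∀ x, x ∈ I ↔ ¬IsUnit x)
    (hK : ∀ x, x ∈ K ↔ algebraMap R V δ ∣ x) {b c : R} (hc : IsUnit (algebraMap R V c)) :
    (annDvd b c).invariant (I ⧸ Submodule.submoduleOf K I) = 1 := by
  refine invariant_eq_one_of_le fun x _ => ?_
  obtain ⟨x, rfl⟩ := Submodule.Quotient.mk_surjective _ x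
  exact (mem_lower_annDvd_idealQuotient hI hK b c x).2
    (Or.inr fun h => (hI x).1 x.2 (isUnit_of_dvd_unit h hc))

theorem invariant_annDvd_idealQuotient_eq_one_of_isUnit_left (hI : ∀ x, x ∈ I ↔ ¬IsUnit x)
    (hK : ∀ x, x ∈ K ↔ algebraMap R V δ ∣ x) {b c : R} (hb : IsUnit (algebraMap R V b)) :
    (annDvd b c).invariant (I ⧸ Submodule.submoduleOf K I) = 1 := by
  refine invariant_eq_one_of_le fun x hx => ?_
  obtain ⟨x, rfl⟩ := Submodule.Quotient.mk_surjective _ x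
  rw [mem_upper_annDvd, smul_mk_idealQuotient_eq_zero_iff hK, hb.dvd_mul_left] at hx
  exact (mem_lower_annDvd_idealQuotient hI hK b c x).2 (Or.inl hx)

theorem invariant_annDvd_idealQuotient_eq_top_of_dvd (hI : ∀ x, x ∈ I ↔ ¬IsUnit x)
    (hK : ∀ x, x ∈ K ↔ algebraMap R V δ ∣ x) (hd : NonunitsSplit V) (hδ : algebraMap R V δ ≠ 0)
    (hδu : ¬IsUnit (algebraMap R V δ)) {b c : R} (hb : algebraMap R V δ ∣ algebraMap R V b)
    (hc : ¬IsUnit (algebraMap R V c)) :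
    (annDvd b c).invariant (I ⧸ Submodule.submoduleOf K I) = ⊤ := by
  obtain ⟨e, he0, heu, he⟩ := exists_common_bound hδ hδu hc
  refine invariant_idealQuotient_eq_top hI hd he0 heu 1 (fun y _ => ?_) fun z _ hz => ?_
  · rw [mem_upper_annDvd, smul_mk_idealQuotient_eq_zero_iff hK]
    exact hb.mul_right _
  · obtain ⟨h1, -, -, h4⟩ := he z hz
    rw [mem_lower_annDvd_idealQuotient hI hK, not_or, not_not]
    simpa only [one_mul] using ⟨h1, h4⟩

theorem exists_eq_mul_of_not_dvd (hδ : algebraMap R V δ ≠ 0) {b : R}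
    (hb : ¬algebraMap R V δ ∣ algebraMap R V b) :
    ∃ f, ¬IsUnit f ∧ algebraMap R V δ = algebraMap R V b * f ∧ algebraMap R V b ≠ 0 ∧ f ≠ 0 := by
  obtain ⟨f, hfu, hf⟩ := exists_nonunit_mul_of_not_dvd hb
  exact ⟨f, hfu, hf, fun h0 => hδ (by rw [hf, h0, zero_mul]),
    fun h0 => hδ (by rw [hf, h0, mul_zero])⟩

theorem invariant_annDvd_idealQuotient_eq_top (hI : ∀ x, x ∈ I ↔ ¬IsUnit x)
    (hK : ∀ x, x ∈ K ↔ algebraMap R V δ ∣ x) (hd : NonunitsSplit V) (hδ : algebraMap R V δ ≠ 0)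
    {b c : R} (hb : ¬algebraMap R V δ ∣ algebraMap R V b) (hbu : ¬IsUnit (algebraMap R V b))
    (h : ¬algebraMap R V (c * b) ∣ algebraMap R V δ) :
    (annDvd b c).invariant (I ⧸ Submodule.submoduleOf K I) = ⊤ := by
  obtain ⟨f, hfu, hf, hb0, hf0⟩ := exists_eq_mul_of_not_dvd hδ hb
  have hcf : ¬algebraMap R V c ∣ f := fun h' => h (by
    rw [map_mul, hf, mul_comm]
    exact mul_dvd_mul_left _ h')
  obtain ⟨c', hc', hc⟩ := exists_nonunit_mul_of_not_dvd hcf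
  obtain ⟨e, he0, heu, he⟩ := exists_common_bound hb0 hbu hc'
  refine invariant_idealQuotient_eq_top hI hd he0 heu f (fun y _ => ?_) fun z _ hz => ?_
  · rw [mem_upper_annDvd, smul_mk_idealQuotient_eq_zero_iff hK, ← mul_assoc, ← hf]
    exact dvd_mul_right _ _
  · obtain ⟨h1, -, -, h4⟩ := he z hz
    rw [mem_lower_annDvd_idealQuotient hI hK, not_or, not_not, hc, hf, mul_comm _ f,
      mul_dvd_mul_iff_left hf0]
    exact ⟨h1, mul_dvd_mul_left f h4⟩

theorem invariant_annDvd_idealQuotient_eq_one (hI : ∀ x, x ∈ I ↔ ¬IsUnit x)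
    (hK : ∀ x, x ∈ K ↔ algebraMap R V δ ∣ x) (hδ : algebraMap R V δ ≠ 0) {b c : R}
    (hb : ¬algebraMap R V δ ∣ algebraMap R V b)
    (h : ¬algebraMap R V δ ∣ algebraMap R V (c * b)) :
    (annDvd b c).invariant (I ⧸ Submodule.submoduleOf K I) = 1 := by
  obtain ⟨f, -, hf, hb0, -⟩ := exists_eq_mul_of_not_dvd hδ hb
  refine invariant_eq_one_of_le fun x hx => ?_
  obtain ⟨x, rfl⟩ := Submodule.Quotient.mk_surjective _ x
  rw [mem_upper_annDvd, smul_mk_idealQuotient_eq_zero_iff hK, hf,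
    mul_dvd_mul_iff_left hb0] at hx
  refine (mem_lower_annDvd_idealQuotient hI hK b c x).2 (Or.inr fun hxc => h ?_)
  rw [map_mul, hf, mul_comm]
  exact mul_dvd_mul_right (hx.trans hxc) _

theorem invariant_annDvd_idealQuotient_eq_card (hI : ∀ x, x ∈ I ↔ ¬IsUnit x)
    (hK : ∀ x, x ∈ K ↔ algebraMap R V δ ∣ x) (hδ : algebraMap R V δ ≠ 0) {b c : R}
    (hb : ¬algebraMap R V δ ∣ algebraMap R V b) (hbu : ¬IsUnit (algebraMap R V b))
    (h : algebraMap R V (c * b) ∣ algebraMap R V δ)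
    (h' : algebraMap R V δ ∣ algebraMap R V (c * b)) :
    (annDvd b c).invariant (I ⧸ Submodule.submoduleOf K I) =
      ENat.card (V ⧸ IsLocalRing.maximalIdeal V) := by
  obtain ⟨f, hfu, hf, hb0, hf0⟩ := exists_eq_mul_of_not_dvd hδ hb
  rw [map_mul, hf, mul_comm (algebraMap R V c), mul_dvd_mul_iff_left hb0] at h h'
  have hc : algebraMap R V c ∈ I := (hI _).2 fun hu => hfu (isUnit_of_dvd_unit h' hu)
  have hc0 : algebraMap R V c ≠ 0 := fun h0 => hf0 (zero_dvd_iff.1 (h0 ▸ h))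
  let g : V →ₗ[R] I ⧸ Submodule.submoduleOf K I :=
    ((Submodule.submoduleOf K I).mkQ ∘ₗ LinearMap.toSpanSingleton V I
      ⟨algebraMap R V c, hc⟩).restrictScalars R
  have hg : ∀ v, g v = Submodule.Quotient.mk ⟨algebraMap R V c * v, I.mul_mem_right v hc⟩ := by
    intro v
    change Submodule.Quotient.mk _ = _
    congr 1
    exact Subtype.ext (mul_comm _ _)
  refine invariant_eq_card_residue g (fun v => ?_) (fun x hx => ?_) fun v => ?_
  · rw [hg, mem_upper_annDvd, smul_mk_idealQuotient_eq_zero_iff hK, hf]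
    exact mul_dvd_mul_left _ (h'.mul_right v)
  · obtain ⟨x, rfl⟩ := Submodule.Quotient.mk_surjective _ x
    rw [mem_upper_annDvd, smul_mk_idealQuotient_eq_zero_iff hK, hf,
      mul_dvd_mul_iff_left hb0] at hx
    obtain ⟨v, hv⟩ := h.trans hx
    refine ⟨v, ?_⟩
    have : Submodule.Quotient.mk x - g v = 0 := by
      rw [hg, sub_eq_zero]
      congr 1
      exact Subtype.ext hv
    rw [this]
    exact zero_mem _
  · rw [hg, mem_lower_annDvd_idealQuotient hI hK]
    constructor
    · rintro (hv | hv) hu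
      · refine hbu (isUnit_of_dvd_unit ?_ hu)
        rw [hf, mul_comm] at hv
        exact (mul_dvd_mul_iff_left hc0).1 ((mul_dvd_mul_right h _).trans hv)
      · exact hv ((hu.mul_right_dvd).2 dvd_rfl)
    · refine fun hv => Or.inr fun hdvd => hv (isUnit_of_dvd_one ((mul_dvd_mul_iff_left hc0).1 ?_))
      rwa [mul_one]

end IdealQuotient

end PPPair

end LocalInvariants

section Comparison

variable {R : Type u} [CommRing R]

theorem isUnit_algebraMap_atPrime_iff (m : MaximalSpectrum R) (x : R) :
    IsUnit (algebraMap R (Localization.AtPrime m.asIdeal) x) ↔ x ∉ m.asIdeal :=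
  IsLocalization.AtPrime.isUnit_to_map_iff _ m.asIdeal x

theorem exists_colon_elements [IsDomain R] [IsPruferDomain R] (x y : R) :
    ∃ α s : R, x ∣ y * α ∧ y * s + x * α = x ∧ (y = 0 → α = 1) := by
  by_cases hy : y = 0
  · exact ⟨1, 0, by simp [hy], by simp, fun _ => rfl⟩
  let A : Ideal R := (Ideal.span {x}).colon {y}
  let B : Ideal R := (Ideal.span {y}).colon {x}
  have memA : ∀ r, r ∈ A ↔ x ∣ r * y := fun r => by
    simp [A, Submodule.mem_colon_singleton, Ideal.mem_span_singleton]
  have memB : ∀ r, r ∈ B ↔ y ∣ r * x := fun r => by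
    simp [B, Submodule.mem_colon_singleton, Ideal.mem_span_singleton]
  have hloc : ∀ (m : Ideal R) [m.IsMaximal] (u v : R),
      algebraMap R (Localization.AtPrime m) u ∣ algebraMap R (Localization.AtPrime m) v →
      ∃ t ∉ m, u ∣ t * v := by
    intro m _ u v h
    obtain ⟨q, hq⟩ := h
    obtain ⟨⟨r, t⟩, hrt⟩ := IsLocalization.surj m.primeCompl q
    refine ⟨t, t.2, r, IsLocalization.injective (Localization.AtPrime m)
      m.primeCompl_le_nonZeroDivisors ?_⟩
    rw [map_mul, map_mul, hq, ← hrt]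
    ring
  have htop : A ⊔ B = ⊤ := by
    by_contra hne
    obtain ⟨m, hm, hle⟩ := Ideal.exists_le_maximal _ hne
    rcases ValuationRing.dvd_total (algebraMap R (Localization.AtPrime m) x)
      (algebraMap R (Localization.AtPrime m) y) with h | h
    · obtain ⟨t, ht, h⟩ := hloc m x y h
      exact ht (hle (le_sup_left (a := A) ((memA t).2 h)))
    · obtain ⟨t, ht, h⟩ := hloc m y x h
      exact ht (hle (le_sup_right (a := A) ((memB t).2 h)))
  obtain ⟨α, hα, α', hα', hsum⟩ := Submodule.mem_sup.1 (htop ▸ Submodule.mem_top : (1 : R) ∈ A ⊔ B)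
  obtain ⟨s, hs⟩ := (memB α').1 hα'
  refine ⟨α, s, by rw [mul_comm]; exact (memA α).1 hα, ?_, fun h => absurd h hy⟩
  rw [← hs, mul_comm x, ← add_mul, add_comm α', hsum, one_mul]

theorem algebraMap_dvd_iff_of_colon_elements [IsDomain R] {x y α s : R} (h₁ : x ∣ y * α)
    (h₂ : y * s + x * α = x) (h₃ : y = 0 → α = 1) (m : MaximalSpectrum R) :
    algebraMap R (Localization.AtPrime m.asIdeal) x ∣
      algebraMap R (Localization.AtPrime m.asIdeal) y ↔ α ∉ m.asIdeal ∨ s ∉ m.asIdeal := by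
  let V := Localization.AtPrime m.asIdeal
  have hinj : Function.Injective (algebraMap R V) :=
    IsLocalization.injective V m.asIdeal.primeCompl_le_nonZeroDivisors
  constructor
  · rintro ⟨q, hq⟩
    by_contra! hcon
    obtain ⟨hα, hs⟩ := hcon
    have hα1 : IsUnit (algebraMap R V (1 - α)) :=
      (isUnit_algebraMap_atPrime_iff m _).2 fun h =>
        m.isMaximal.ne_top ((Ideal.eq_top_iff_one _).2 (by simpa using add_mem h hα))
    have hy : y ≠ 0 := fun h => m.isMaximal.ne_top
      ((Ideal.eq_top_iff_one _).2 (h₃ h ▸ hα))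
    have hx : algebraMap R V x * algebraMap R V (1 - α) = algebraMap R V y * algebraMap R V s := by
      rw [← map_mul, ← map_mul]
      congr 1
      linear_combination -h₂
    have hy' : algebraMap R V y ≠ 0 := (map_ne_zero_iff _ hinj).2 hy
    have h1 : algebraMap R V (1 - α) = algebraMap R V s * q := by
      refine mul_left_cancel₀ hy' ?_
      calc algebraMap R V y * algebraMap R V (1 - α)
          = algebraMap R V x * algebraMap R V (1 - α) * q := by rw [hq]; ring
        _ = _ := by rw [hx, mul_assoc]
    rw [h1] at hα1
    exact (isUnit_algebraMap_atPrime_iff m s).1 (isUnit_of_mul_isUnit_left hα1) hs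
  · rintro (h | h)
    · have hu := (isUnit_algebraMap_atPrime_iff m α).2 h
      rw [← hu.dvd_mul_right, ← map_mul]
      exact map_dvd _ h₁
    · have hu := (isUnit_algebraMap_atPrime_iff m s).2 h
      rw [← hu.dvd_mul_right, ← map_mul]
      exact map_dvd _ ⟨1 - α, by linear_combination h₂⟩

/-- `cmp` assigns to the indices of `x` and `y` the indices of two elements such that `x ∣ y` in
`R_m` iff `m` omits one of them. -/
def IsComparison (a : ℕ → R) (cmp : ℕ × ℕ → ℕ × ℕ) : Prop :=
  ∀ (x y : ℕ) (m : MaximalSpectrum R),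
    algebraMap R (Localization.AtPrime m.asIdeal) (a x) ∣
      algebraMap R (Localization.AtPrime m.asIdeal) (a y) ↔
    a (cmp (x, y)).1 ∉ m.asIdeal ∨ a (cmp (x, y)).2 ∉ m.asIdeal

theorem exists_isComparison [IsDomain R] [IsPruferDomain R] {a : ℕ → R}
    (ha : IsEffectiveListing a) : ∃ cmp, Computable cmp ∧ IsComparison a cmp := by
  obtain ⟨add, hadd, hadd'⟩ := ha.add_computable
  obtain ⟨mul, hmul, hmul'⟩ := ha.mul_computable
  obtain ⟨eqB, heq, heq'⟩ := ComputablePred.computable_iff.1 ha.eq_decidable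
  obtain ⟨dvdB, hdvd, hdvd'⟩ := ComputablePred.computable_iff.1 ha.dvd_decidable
  have heqB : ∀ i j, eqB (i, j) = true ↔ a i = a j := fun i j => (congrFun heq' (i, j)).to_iff.symm
  have hdvdB : ∀ i j, dvdB (i, j) = true ↔ a i ∣ a j := fun i j =>
    (congrFun hdvd' (i, j)).to_iff.symm
  let P : ℕ × ℕ → ℕ → Prop := fun q n =>
    a q.1 ∣ a q.2 * a n.unpair.1 ∧ a q.2 * a n.unpair.2 + a q.1 * a n.unpair.1 = a q.1 ∧
      (a q.2 = 0 → a n.unpair.1 = 1)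
  have hP : ComputablePred fun q : (ℕ × ℕ) × ℕ => P q.1 q.2 := by
    have hx : Computable fun q : (ℕ × ℕ) × ℕ => q.1.1 := Computable.fst.comp Computable.fst
    have hy : Computable fun q : (ℕ × ℕ) × ℕ => q.1.2 := Computable.snd.comp Computable.fst
    have hn : Computable fun q : (ℕ × ℕ) × ℕ => q.2.unpair :=
      Computable.unpair.comp Computable.snd
    have hα : Computable fun q : (ℕ × ℕ) × ℕ => q.2.unpair.1 := Computable.fst.comp hn
    have hs : Computable fun q : (ℕ × ℕ) × ℕ => q.2.unpair.2 := Computable.snd.comp hn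
    have h1 : Computable fun q : (ℕ × ℕ) × ℕ => dvdB (q.1.1, mul (q.1.2, q.2.unpair.1)) :=
      hdvd.comp (Computable.pair hx (hmul.comp (Computable.pair hy hα)))
    have h2 : Computable fun q : (ℕ × ℕ) × ℕ =>
        eqB (add (mul (q.1.2, q.2.unpair.2), mul (q.1.1, q.2.unpair.1)), q.1.1) :=
      heq.comp (Computable.pair (hadd.comp (Computable.pair (hmul.comp (Computable.pair hy hs))
        (hmul.comp (Computable.pair hx hα)))) hx)
    have h3 : Computable fun q : (ℕ × ℕ) × ℕ => eqB (q.1.2, 0) :=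
      heq.comp (Computable.pair hy (Computable.const 0))
    have h4 : Computable fun q : (ℕ × ℕ) × ℕ => eqB (q.2.unpair.1, 1) :=
      heq.comp (Computable.pair hα (Computable.const 1))
    rw [ComputablePred.computable_iff]
    refine ⟨_, Primrec.and.to_comp.comp h1 (Primrec.and.to_comp.comp h2
      (Primrec.or.to_comp.comp (Primrec.not.to_comp.comp h3) h4)), ?_⟩
    funext q
    simp only [P, Bool.and_eq_true, Bool.or_eq_true, Bool.not_eq_true', ← Bool.not_eq_true, heqB,
      hdvdB, hmul', hadd', ha.zero, ha.one, imp_iff_not_or]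
  obtain ⟨f, hf, hfP⟩ := Computable.exists_search hP fun q => by
    obtain ⟨α, s, h⟩ := exists_colon_elements (a q.1) (a q.2)
    obtain ⟨i, rfl⟩ := ha.surjective α
    obtain ⟨j, rfl⟩ := ha.surjective s
    exact ⟨Nat.pair i j, by simpa [P] using h⟩
  refine ⟨fun q => (f q).unpair, Computable.unpair.comp hf, fun x y m => ?_⟩
  obtain ⟨h1, h2, h3⟩ := hfP (x, y)
  exact algebraMap_dvd_iff_of_colon_elements h1 h2 h3 m

theorem IsComparison.isUnit_iff {a : ℕ → R} {cmp : ℕ × ℕ → ℕ × ℕ} (hcmp : IsComparison a cmp)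
    (h1 : a 1 = 1) (x : ℕ) (m : MaximalSpectrum R) :
    IsUnit (algebraMap R (Localization.AtPrime m.asIdeal) (a x)) ↔
      a (cmp (x, 1)).1 ∉ m.asIdeal ∨ a (cmp (x, 1)).2 ∉ m.asIdeal := by
  rw [← hcmp, h1, map_one, isUnit_iff_dvd_one]

end Comparison

section Cells

/-- The trivial decomposition into one cell with the given exponent. -/
def leafCell (e : ℕ × ℕ) : List Cell := [([], [], e)]

/-- Refine the decomposition `A` on the set of maximal ideals omitting `s.1` or `s.2`, and `B` on
its complement. -/
def branchCells (s : ℕ × ℕ) (A B : List Cell) : List Cell :=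
  A.map (fun c => (c.1, s.1 :: c.2.1, c.2.2)) ++ (A.map (fun c => (c.1, s.2 :: c.2.1, c.2.2)) ++
    B.map fun c => (s.1 :: s.2 :: c.1, c.2))

theorem computable_branchCells {α : Type*} [Primcodable α] {s : α → ℕ × ℕ} {A B : α → List Cell}
    (hs : Computable s) (hA : Computable A) (hB : Computable B) :
    Computable fun x => branchCells (s x) (A x) (B x) := by
  have hc : Computable fun x : α × Cell => x.2 := Computable.snd
  have h1 : Computable fun x : α × Cell => (s x.1).1 :=
    Computable.fst.comp (hs.comp Computable.fst)
  have h2 : Computable fun x : α × Cell => (s x.1).2 :=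
    Computable.snd.comp (hs.comp Computable.fst)
  have hC : Computable fun x : α × Cell => x.2.1 := Computable.fst.comp hc
  have hD : Computable fun x : α × Cell => x.2.2.1 := Computable.fst.comp (Computable.snd.comp hc)
  have he : Computable fun x : α × Cell => x.2.2.2 := Computable.snd.comp (Computable.snd.comp hc)
  have k1 : Computable fun x : α × Cell => (x.2.1, (s x.1).1 :: x.2.2.1, x.2.2.2) :=
    Computable.pair hC (Computable.pair (Computable.list_cons.comp h1 hD) he)
  have k2 : Computable fun x : α × Cell => (x.2.1, (s x.1).2 :: x.2.2.1, x.2.2.2) :=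
    Computable.pair hC (Computable.pair (Computable.list_cons.comp h2 hD) he)
  have k3 : Computable fun x : α × Cell => ((s x.1).1 :: (s x.1).2 :: x.2.1, x.2.2) :=
    Computable.pair (Computable.list_cons.comp h1 (Computable.list_cons.comp h2 hC))
      (Computable.snd.comp hc)
  have l1 : Computable fun x => (A x).map fun c => (c.1, (s x).1 :: c.2.1, c.2.2) :=
    Computable.list_map hA k1.to₂
  have l2 : Computable fun x => (A x).map fun c => (c.1, (s x).2 :: c.2.1, c.2.2) :=
    Computable.list_map hA k2.to₂
  have l3 : Computable fun x => (B x).map fun c => ((s x).1 :: (s x).2 :: c.1, c.2) :=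
    Computable.list_map hB k3.to₂
  exact (Computable.list_append.comp l1 (Computable.list_append.comp l2 l3)).of_eq fun _ => rfl

variable {R : Type u} [CommRing R]

/-- Some cell in `L` contains `m`, and all cells which do have an exponent giving the value `x`. -/
def CellsCompute (a : ℕ → R) (m : MaximalSpectrum R) (L : List Cell) (x : ℕ∞) : Prop :=
  (∃ c ∈ L, InCell a m c.1 c.2.1) ∧
    ∀ c ∈ L, InCell a m c.1 c.2.1 → x = powExp (ENat.card (R ⧸ m.asIdeal)) c.2.2

variable {a : ℕ → R} {m : MaximalSpectrum R} {x : ℕ∞}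

theorem cellsCompute_leafCell {e : ℕ × ℕ} (h : x = powExp (ENat.card (R ⧸ m.asIdeal)) e) :
    CellsCompute a m (leafCell e) x := by
  simp [CellsCompute, leafCell, InCell, h]

theorem cellsCompute_one (h : x = 1) : CellsCompute a m (leafCell (0, 0)) x :=
  cellsCompute_leafCell (by simp [powExp, h])

theorem cellsCompute_card (h : x = ENat.card (R ⧸ m.asIdeal)) :
    CellsCompute a m (leafCell (0, 1)) x :=
  cellsCompute_leafCell (by simp [powExp, h])

theorem cellsCompute_top (h : x = ⊤) : CellsCompute a m (leafCell (1, 0)) x :=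
  cellsCompute_leafCell (by simp [powExp, h])

theorem cellsCompute_branchCells {Q : Prop} {s : ℕ × ℕ} {A B : List Cell}
    (hQ : Q ↔ a s.1 ∉ m.asIdeal ∨ a s.2 ∉ m.asIdeal) (hA : Q → CellsCompute a m A x)
    (hB : ¬Q → CellsCompute a m B x) : CellsCompute a m (branchCells s A B) x := by
  have hmem : ∀ c, c ∈ branchCells s A B ↔ (∃ c' ∈ A, c = (c'.1, s.1 :: c'.2.1, c'.2.2)) ∨
      (∃ c' ∈ A, c = (c'.1, s.2 :: c'.2.1, c'.2.2)) ∨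
      ∃ c' ∈ B, c = (s.1 :: s.2 :: c'.1, c'.2) := by
    intro c
    simp only [branchCells, List.mem_append, List.mem_map, eq_comm]
  have hcons : ∀ (C D : List ℕ) (d : ℕ),
      InCell a m C (d :: D) ↔ a d ∉ m.asIdeal ∧ InCell a m C D := by
    intro C D d
    simp only [InCell, List.mem_cons, forall_eq_or_imp]
    tauto
  have hcons' : ∀ (C D : List ℕ), InCell a m (s.1 :: s.2 :: C) D ↔ ¬Q ∧ InCell a m C D := by
    intro C D
    rw [hQ]
    simp only [InCell, List.mem_cons, forall_eq_or_imp]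
    tauto
  constructor
  · by_cases h : Q
    · obtain ⟨c, hc, hin⟩ := (hA h).1
      rcases hQ.1 h with h' | h'
      · exact ⟨_, (hmem _).2 (Or.inl ⟨c, hc, rfl⟩), (hcons _ _ _).2 ⟨h', hin⟩⟩
      · exact ⟨_, (hmem _).2 (Or.inr (Or.inl ⟨c, hc, rfl⟩)), (hcons _ _ _).2 ⟨h', hin⟩⟩
    · obtain ⟨c, hc, hin⟩ := (hB h).1
      exact ⟨_, (hmem _).2 (Or.inr (Or.inr ⟨c, hc, rfl⟩)), (hcons' _ _).2 ⟨h, hin⟩⟩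
  · intro c hc hin
    rcases (hmem c).1 hc with ⟨c', hc', rfl⟩ | ⟨c', hc', rfl⟩ | ⟨c', hc', rfl⟩
    · have h := (hcons _ _ _).1 hin
      exact (hA (hQ.2 (Or.inl h.1))).2 c' hc' h.2
    · have h := (hcons _ _ _).1 hin
      exact (hA (hQ.2 (Or.inr h.1))).2 c' hc' h.2
    · have h := (hcons' _ _).1 hin
      exact (hB h.1).2 c' hc' h.2

theorem isCellDecomposition_of_cellsCompute {N : MaximalSpectrum R → Type u}
    [∀ m, AddCommGroup (N m)] [∀ m, Module R (N m)] {P : Set (MaximalSpectrum R)}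
    {cells : PairCode → List Cell} (h : ∀ m ∈ P, ∀ π,
      CellsCompute a m (cells π) ((PairCode.toPair a π).invariant (N m))) :
    IsCellDecomposition a N P cells :=
  ⟨fun m hm π => (h m hm π).1, fun m hm π => (h m hm π).2⟩

end Cells

section Classes

variable {R : Type u} [CommRing R]

theorem Computable.sum_elim {α β σ : Type*} [Primcodable α] [Primcodable β] [Primcodable σ]
    {f : α → σ} {g : β → σ} (hf : Computable f) (hg : Computable g) :
    Computable (Sum.elim f g) := by
  have hf' : Computable fun x : (α ⊕ β) × α => f x.2 := hf.comp Computable.snd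
  have hg' : Computable fun x : (α ⊕ β) × β => g x.2 := hg.comp Computable.snd
  exact (Computable.sumCasesOn Computable.id hf'.to₂ hg'.to₂).of_eq fun x => by cases x <;> rfl

theorem mem_map_atPrime_iff (m : MaximalSpectrum R) (x : Localization.AtPrime m.asIdeal) :
    x ∈ m.asIdeal.map (algebraMap R (Localization.AtPrime m.asIdeal)) ↔ ¬IsUnit x := by
  rw [Localization.AtPrime.map_eq_maximalIdeal]
  exact IsLocalRing.mem_maximalIdeal x

theorem card_residue_atPrime [IsDomain R] [IsPruferDomain R] (m : MaximalSpectrum R) :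
    ENat.card (Localization.AtPrime m.asIdeal ⧸
      IsLocalRing.maximalIdeal (Localization.AtPrime m.asIdeal)) =
      ENat.card (R ⧸ m.asIdeal) :=
  (ENat.card_congr (IsLocalization.AtPrime.equivQuotMaximalIdeal m.asIdeal
    (Localization.AtPrime m.asIdeal)).toEquiv).symm

theorem algebraMap_atPrime_ne_zero [IsDomain R] (m : MaximalSpectrum R) {x : R} (hx : x ≠ 0) :
    algebraMap R (Localization.AtPrime m.asIdeal) x ≠ 0 :=
  (map_ne_zero_iff _ (IsLocalization.injective (Localization.AtPrime m.asIdeal)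
    m.asIdeal.primeCompl_le_nonZeroDivisors)).2 hx

theorem mem_span_mul_map_atPrime_iff [IsDomain R] [IsPruferDomain R] {γ : R} (hγ : γ ≠ 0)
    (m : MaximalSpectrum R) (x : Localization.AtPrime m.asIdeal) :
    x ∈ Ideal.span {algebraMap R (Localization.AtPrime m.asIdeal) γ} *
      m.asIdeal.map (algebraMap R (Localization.AtPrime m.asIdeal)) ↔
      ¬x ∣ algebraMap R (Localization.AtPrime m.asIdeal) γ := by
  rw [Ideal.mem_span_singleton_mul]
  constructor
  · rintro ⟨z, hz, rfl⟩ h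
    rw [mem_map_atPrime_iff] at hz
    refine hz (isUnit_of_dvd_one
      ((mul_dvd_mul_iff_left (algebraMap_atPrime_ne_zero m hγ)).1 ?_))
    rwa [mul_one]
  · intro h
    obtain ⟨n, hn, hx⟩ := exists_nonunit_mul_of_not_dvd h
    exact ⟨n, (mem_map_atPrime_iff m n).2 hn, hx.symm⟩

/-- Cell decompositions for the modules `R_m / γ m R_m`, where `g` is the index of `γ`. -/
def nModCells (cmp : ℕ × ℕ → ℕ × ℕ) (mul : ℕ × ℕ → ℕ) (g : ℕ) : PairCode → List Cell :=
  Sum.elim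
    (fun q => branchCells (cmp (q.1, g))
      (branchCells (cmp (mul (q.2, q.1), g)) (leafCell (0, 0))
        (branchCells (cmp (q.1, 1)) (leafCell (0, 0)) (leafCell (1, 0))))
      (branchCells (cmp (q.2, 1)) (leafCell (0, 0))
        (branchCells (cmp (q.2, g)) (leafCell (1, 0))
          (branchCells (cmp (g, 1)) (leafCell (0, 1)) (leafCell (1, 0))))))
    (fun d => branchCells (cmp (d, g))
      (branchCells (cmp (g, d)) (leafCell (0, 1)) (leafCell (1, 0))) (leafCell (0, 0)))

/-- Cell decompositions for the modules `m R_m / δ R_m`, where `g` is the index of `δ`. -/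
def nModCells' (cmp : ℕ × ℕ → ℕ × ℕ) (mul : ℕ × ℕ → ℕ) (g : ℕ) : PairCode → List Cell :=
  Sum.elim
    (fun q => branchCells (cmp (g, q.1))
      (branchCells (cmp (q.2, 1)) (leafCell (0, 0)) (leafCell (1, 0)))
      (branchCells (cmp (q.1, 1)) (leafCell (0, 0))
        (branchCells (cmp (mul (q.2, q.1), g))
          (branchCells (cmp (g, mul (q.2, q.1))) (leafCell (0, 1)) (leafCell (0, 0)))
          (leafCell (1, 0)))))
    (fun d => branchCells (cmp (g, d)) (leafCell (0, 0)) (leafCell (1, 0)))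

/-- Cell decompositions for the modules `R / m`. -/
def residueCells (cmp : ℕ × ℕ → ℕ × ℕ) : PairCode → List Cell :=
  Sum.elim
    (fun q => branchCells (cmp (q.1, 1)) (leafCell (0, 0))
      (branchCells (cmp (q.2, 1)) (leafCell (0, 0)) (leafCell (0, 1))))
    (fun d => branchCells (cmp (d, 1)) (leafCell (0, 1)) (leafCell (0, 0)))

section Computability

variable {cmp : ℕ × ℕ → ℕ × ℕ} {mul : ℕ × ℕ → ℕ}

theorem computable_nModCells (hcmp : Computable cmp) (hmul : Computable mul) (g : ℕ) :
    Computable (nModCells cmp mul g) := by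
  have hc : ∀ (α : Type) [Primcodable α] (n : ℕ), Computable fun _ : α => n :=
    fun _ _ n => Computable.const n
  have hl : ∀ (α : Type) [Primcodable α] (e : ℕ × ℕ), Computable fun _ : α => leafCell e :=
    fun _ _ e => Computable.const _
  have hcb : Computable fun q : ℕ × ℕ => mul (q.2, q.1) :=
    hmul.comp (Computable.pair Computable.snd Computable.fst)
  have hb1 := hcmp.comp (Computable.pair Computable.fst (hc (ℕ × ℕ) 1))
  have hbg := hcmp.comp (Computable.pair Computable.fst (hc (ℕ × ℕ) g))
  have hc1 := hcmp.comp (Computable.pair Computable.snd (hc (ℕ × ℕ) 1))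
  have hcg := hcmp.comp (Computable.pair Computable.snd (hc (ℕ × ℕ) g))
  have hcbg := hcmp.comp (Computable.pair hcb (hc (ℕ × ℕ) g))
  refine Computable.sum_elim ?_ ?_
  · exact computable_branchCells hbg
      (computable_branchCells hcbg (hl _ _) (computable_branchCells hb1 (hl _ _) (hl _ _)))
      (computable_branchCells hc1 (hl _ _) (computable_branchCells hcg (hl _ _)
        (computable_branchCells (Computable.const _) (hl _ _) (hl _ _))))
  · exact computable_branchCells (hcmp.comp (Computable.pair Computable.id (hc ℕ g)))
      (computable_branchCells (hcmp.comp (Computable.pair (hc ℕ g) Computable.id)) (hl _ _)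
        (hl _ _)) (hl _ _)

theorem computable_nModCells' (hcmp : Computable cmp) (hmul : Computable mul) (g : ℕ) :
    Computable (nModCells' cmp mul g) := by
  have hc : ∀ (α : Type) [Primcodable α] (n : ℕ), Computable fun _ : α => n :=
    fun _ _ n => Computable.const n
  have hl : ∀ (α : Type) [Primcodable α] (e : ℕ × ℕ), Computable fun _ : α => leafCell e :=
    fun _ _ e => Computable.const _
  have hcb : Computable fun q : ℕ × ℕ => mul (q.2, q.1) :=
    hmul.comp (Computable.pair Computable.snd Computable.fst)
  have hb1 := hcmp.comp (Computable.pair Computable.fst (hc (ℕ × ℕ) 1))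
  have hgb := hcmp.comp (Computable.pair (hc (ℕ × ℕ) g) Computable.fst)
  have hc1 := hcmp.comp (Computable.pair Computable.snd (hc (ℕ × ℕ) 1))
  have hcbg := hcmp.comp (Computable.pair hcb (hc (ℕ × ℕ) g))
  have hgcb := hcmp.comp (Computable.pair (hc (ℕ × ℕ) g) hcb)
  refine Computable.sum_elim ?_ ?_
  · exact computable_branchCells hgb (computable_branchCells hc1 (hl _ _) (hl _ _))
      (computable_branchCells hb1 (hl _ _) (computable_branchCells hcbg
        (computable_branchCells hgcb (hl _ _) (hl _ _)) (hl _ _)))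
  · exact computable_branchCells (hcmp.comp (Computable.pair (hc ℕ g) Computable.id))
      (hl _ _) (hl _ _)

theorem computable_residueCells (hcmp : Computable cmp) : Computable (residueCells cmp) := by
  have hc : ∀ (α : Type) [Primcodable α] (n : ℕ), Computable fun _ : α => n :=
    fun _ _ n => Computable.const n
  have hl : ∀ (α : Type) [Primcodable α] (e : ℕ × ℕ), Computable fun _ : α => leafCell e :=
    fun _ _ e => Computable.const _
  have hb1 := hcmp.comp (Computable.pair Computable.fst (hc (ℕ × ℕ) 1))
  have hc1 := hcmp.comp (Computable.pair Computable.snd (hc (ℕ × ℕ) 1))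
  refine Computable.sum_elim ?_ ?_
  · exact computable_branchCells hb1 (hl _ _) (computable_branchCells hc1 (hl _ _) (hl _ _))
  · exact computable_branchCells (hcmp.comp (Computable.pair Computable.id (hc ℕ 1)))
      (hl _ _) (hl _ _)

end Computability

section Decompositions

variable {a : ℕ → R} {cmp : ℕ × ℕ → ℕ × ℕ} {mul : ℕ × ℕ → ℕ}

theorem isCellDecomposition_nModCells [IsDomain R] [IsPruferDomain R]
    (hdense : HasDenseValueGroups R) (h1 : a 1 = 1) (hcmp : IsComparison a cmp)
    (hmul : ∀ x, a (mul x) = a x.1 * a x.2) {g : ℕ} (hg : a g ≠ 0) :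
    IsCellDecomposition a (fun m => NMod (a g) m) Set.univ (nModCells cmp mul g) := by
  refine isCellDecomposition_of_cellsCompute fun m _ π => ?_
  have hd := (hdense m.asIdeal).nonunitsSplit
  have hJ := mem_span_mul_map_atPrime_iff hg m
  have hγ := algebraMap_atPrime_ne_zero m hg
  have hq := card_residue_atPrime m
  rcases π with ⟨b, c⟩ | d
  · refine cellsCompute_branchCells (hcmp b g m) (fun h => ?_) fun h => ?_
    · refine cellsCompute_branchCells (hcmp _ g m) (fun h' => ?_) fun h' => ?_
      · rw [hmul] at h'
        exact cellsCompute_one (PPPair.invariant_annDvd_quotient_eq_one_of_dvd hJ hγ h')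
      · rw [hmul] at h'
        refine cellsCompute_branchCells (hcmp.isUnit_iff h1 b m) (fun hb => ?_) fun hb => ?_
        · exact cellsCompute_one (PPPair.invariant_annDvd_quotient_eq_one_of_isUnit_left hJ hγ hb)
        · exact cellsCompute_top (PPPair.invariant_annDvd_quotient_eq_top hJ hd hγ h hb h')
    · refine cellsCompute_branchCells (hcmp.isUnit_iff h1 c m) (fun hc => ?_) fun hc => ?_
      · exact cellsCompute_one (PPPair.invariant_annDvd_quotient_eq_one_of_isUnit hJ hγ hc)
      · refine cellsCompute_branchCells (hcmp c g m) (fun h' => ?_) fun h' => ?_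
        · exact cellsCompute_top
            (PPPair.invariant_annDvd_quotient_eq_top_of_not_dvd hJ hd hγ h hc (Or.inl h'))
        · refine cellsCompute_branchCells (hcmp.isUnit_iff h1 g m) (fun hu => ?_) fun hu => ?_
          · exact cellsCompute_card
              ((PPPair.invariant_annDvd_quotient_eq_card hJ hγ h hc hu).trans hq)
          · exact cellsCompute_top
              (PPPair.invariant_annDvd_quotient_eq_top_of_not_dvd hJ hd hγ h hc (Or.inr hu))
  · refine cellsCompute_branchCells (hcmp d g m) (fun h => ?_) fun h => ?_
    · refine cellsCompute_branchCells (hcmp g d m) (fun h' => ?_) fun h' => ?_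
      · exact cellsCompute_card ((PPPair.invariant_topAnn_quotient_eq_card hJ hγ h h').trans hq)
      · exact cellsCompute_top (PPPair.invariant_topAnn_quotient_eq_top hJ hd hγ h')
    · exact cellsCompute_one (PPPair.invariant_topAnn_quotient_eq_one hJ h)

theorem isCellDecomposition_nModCells' [IsDomain R] [IsPruferDomain R]
    (hdense : HasDenseValueGroups R) (h1 : a 1 = 1) (hcmp : IsComparison a cmp)
    (hmul : ∀ x, a (mul x) = a x.1 * a x.2) {β η : R} (hβ : β ≠ 0) (hη : η ≠ 0) {g : ℕ}
    (hg : a g = β * η) : IsCellDecomposition a (fun m => NMod' β η m)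
      {m | β ∈ m.asIdeal ∧ η ∈ m.asIdeal} (nModCells' cmp mul g) := by
  refine isCellDecomposition_of_cellsCompute fun m hm π => ?_
  have hd := (hdense m.asIdeal).nonunitsSplit
  have hI := mem_map_atPrime_iff m
  have hK : ∀ x, x ∈ Ideal.span {algebraMap R (Localization.AtPrime m.asIdeal) (β * η)} ↔
      algebraMap R (Localization.AtPrime m.asIdeal) (β * η) ∣ x := fun x =>
    Ideal.mem_span_singleton
  have hδ := algebraMap_atPrime_ne_zero m (mul_ne_zero hβ hη)
  have hδu : ¬IsUnit (algebraMap R (Localization.AtPrime m.asIdeal) (β * η)) := by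
    rw [isUnit_algebraMap_atPrime_iff, not_not]
    exact m.asIdeal.mul_mem_right _ hm.1
  have hq := card_residue_atPrime m
  rcases π with ⟨b, c⟩ | d
  · refine cellsCompute_branchCells (hcmp g b m) (fun h => ?_) fun h => ?_
    · rw [hg] at h
      refine cellsCompute_branchCells (hcmp.isUnit_iff h1 c m) (fun hc => ?_) fun hc => ?_
      · exact cellsCompute_one (PPPair.invariant_annDvd_idealQuotient_eq_one_of_isUnit hI hK hc)
      · exact cellsCompute_top
          (PPPair.invariant_annDvd_idealQuotient_eq_top_of_dvd hI hK hd hδ hδu h hc)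
    · rw [hg] at h
      refine cellsCompute_branchCells (hcmp.isUnit_iff h1 b m) (fun hb => ?_) fun hb => ?_
      · exact cellsCompute_one
          (PPPair.invariant_annDvd_idealQuotient_eq_one_of_isUnit_left hI hK hb)
      · refine cellsCompute_branchCells (hcmp _ g m) (fun h' => ?_) fun h' => ?_
        · refine cellsCompute_branchCells (hcmp g _ m) (fun h'' => ?_) fun h'' => ?_
          · rw [hmul, hg] at h' h''
            exact cellsCompute_card
              ((PPPair.invariant_annDvd_idealQuotient_eq_card hI hK hδ h hb h' h'').trans hq)
          · rw [hmul, hg] at h''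
            exact cellsCompute_one (PPPair.invariant_annDvd_idealQuotient_eq_one hI hK hδ h h'')
        · rw [hmul, hg] at h'
          exact cellsCompute_top
            (PPPair.invariant_annDvd_idealQuotient_eq_top hI hK hd hδ h hb h')
  · refine cellsCompute_branchCells (hcmp g d m) (fun h => ?_) fun h => ?_
    · rw [hg] at h
      exact cellsCompute_one (PPPair.invariant_topAnn_idealQuotient_eq_one hK h)
    · rw [hg] at h
      exact cellsCompute_top (PPPair.invariant_topAnn_idealQuotient_eq_top hI hK hd hδ h)

theorem PPPair.invariant_annDvd_nMod'_eq_card [IsDomain R] [IsPruferDomain R] {β η : R}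
    (hβ : β ≠ 0) (hη : η ≠ 0) {m : MaximalSpectrum R} (hm : β ∈ m.asIdeal ∧ η ∈ m.asIdeal) :
    (PPPair.annDvd η β).invariant (NMod' β η m) = ENat.card (R ⧸ m.asIdeal) := by
  refine (PPPair.invariant_annDvd_idealQuotient_eq_card (mem_map_atPrime_iff m)
    (fun x => Ideal.mem_span_singleton) (algebraMap_atPrime_ne_zero m (mul_ne_zero hβ hη))
    (fun h => ?_) ?_ dvd_rfl dvd_rfl).trans (card_residue_atPrime m)
  · rw [map_mul, mul_comm] at h
    have h' := (mul_dvd_mul_iff_left (algebraMap_atPrime_ne_zero m hη)).1 (h.trans (mul_one _).symm.dvd)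
    exact (isUnit_algebraMap_atPrime_iff m β).1 (isUnit_of_dvd_one h') hm.1
  · rw [isUnit_algebraMap_atPrime_iff, not_not]
    exact hm.2

theorem PPPair.smul_mk_residue_eq_zero_iff {I : Ideal R} (r x : R) :
    r • (Submodule.Quotient.mk x : R ⧸ I) = 0 ↔ r * x ∈ I := by
  rw [← Submodule.Quotient.mk_smul, Submodule.Quotient.mk_eq_zero, smul_eq_mul]

theorem PPPair.invariant_topAnn_residue (m : MaximalSpectrum R) (d : R) :
    (d ∈ m.asIdeal → (PPPair.topAnn d).invariant (R ⧸ m.asIdeal) = 1) ∧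
      (d ∉ m.asIdeal → (PPPair.topAnn d).invariant (R ⧸ m.asIdeal) =
        ENat.card (R ⧸ m.asIdeal)) := by
  refine ⟨fun h => invariant_eq_one_of_le fun x _ => ?_, fun h =>
    invariant_eq_card_quotient m.asIdeal m.asIdeal.mkQ (fun v => by simp) (fun x _ => ?_)
      fun v => ?_⟩
  · obtain ⟨x, rfl⟩ := Submodule.Quotient.mk_surjective _ x
    rw [mem_lower_topAnn, smul_mk_residue_eq_zero_iff]
    exact m.asIdeal.mul_mem_right x h
  · obtain ⟨x, rfl⟩ := Submodule.Quotient.mk_surjective _ x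
    exact ⟨x, by simp⟩
  · rw [Submodule.mkQ_apply, mem_lower_topAnn, smul_mk_residue_eq_zero_iff,
      m.isMaximal.isPrime.mul_mem_iff_mem_or_mem, or_iff_right h]

theorem PPPair.invariant_annDvd_residue_eq_one (m : MaximalSpectrum R) {b c : R}
    (h : b ∉ m.asIdeal ∨ c ∉ m.asIdeal) :
    (PPPair.annDvd b c).invariant (R ⧸ m.asIdeal) = 1 := by
  refine invariant_eq_one_of_le fun x hx => ?_
  obtain ⟨x, rfl⟩ := Submodule.Quotient.mk_surjective _ x
  rcases h with h | h
  · rw [mem_upper_annDvd, smul_mk_residue_eq_zero_iff,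
      m.isMaximal.isPrime.mul_mem_iff_mem_or_mem, or_iff_right h] at hx
    rw [(Submodule.Quotient.mk_eq_zero _).2 hx]
    exact zero_mem _
  · obtain ⟨y, i, hi, hyi⟩ := m.isMaximal.exists_inv h
    refine ⟨Submodule.Quotient.mk (y * x), ?_⟩
    change c • (Submodule.Quotient.mk (y * x) : R ⧸ m.asIdeal) = _
    rw [← Submodule.Quotient.mk_smul, Submodule.Quotient.eq, smul_eq_mul]
    have : c * (y * x) - x = -x * i := by linear_combination x * hyi
    rw [this]
    exact m.asIdeal.mul_mem_left _ hi

theorem PPPair.invariant_annDvd_residue_eq_card {m : MaximalSpectrum R} {b c : R}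
    (hb : b ∈ m.asIdeal) (hc : c ∈ m.asIdeal) :
    (PPPair.annDvd b c).invariant (R ⧸ m.asIdeal) = ENat.card (R ⧸ m.asIdeal) := by
  refine invariant_eq_card_quotient m.asIdeal m.asIdeal.mkQ (fun v => ?_) (fun x _ => ?_)
      fun v => ?_
  · rw [Submodule.mkQ_apply, mem_upper_annDvd, smul_mk_residue_eq_zero_iff]
    exact m.asIdeal.mul_mem_right v hb
  · obtain ⟨x, rfl⟩ := Submodule.Quotient.mk_surjective _ x
    exact ⟨x, by simp⟩
  · rw [Submodule.mkQ_apply, mem_lower_annDvd, ← Submodule.Quotient.mk_eq_zero m.asIdeal]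
    constructor
    · rintro ⟨y, hy⟩
      obtain ⟨y, rfl⟩ := Submodule.Quotient.mk_surjective _ y
      rw [← hy, smul_mk_residue_eq_zero_iff]
      exact m.asIdeal.mul_mem_right y hc
    · exact fun h => ⟨0, by rw [smul_zero, h]⟩

theorem isCellDecomposition_residueCells (h1 : a 1 = 1) (hcmp : IsComparison a cmp)
    (P : Set (MaximalSpectrum R)) :
    IsCellDecomposition a (fun m => R ⧸ m.asIdeal) P (residueCells cmp) := by
  refine isCellDecomposition_of_cellsCompute fun m _ π => ?_
  have hunit : ∀ x, a x ∉ m.asIdeal ↔ a (cmp (x, 1)).1 ∉ m.asIdeal ∨ a (cmp (x, 1)).2 ∉ m.asIdeal :=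
    fun x => (isUnit_algebraMap_atPrime_iff m (a x)).symm.trans (hcmp.isUnit_iff h1 x m)
  rcases π with ⟨b, c⟩ | d
  · refine cellsCompute_branchCells (hunit b) (fun hb => ?_) fun hb => ?_
    · exact cellsCompute_one (PPPair.invariant_annDvd_residue_eq_one m (Or.inl hb))
    · refine cellsCompute_branchCells (hunit c) (fun hc => ?_) fun hc => ?_
      · exact cellsCompute_one (PPPair.invariant_annDvd_residue_eq_one m (Or.inr hc))
      · exact cellsCompute_card
          (PPPair.invariant_annDvd_residue_eq_card (not_not.1 hb) (not_not.1 hc))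
  · refine cellsCompute_branchCells (hunit d) (fun hd => ?_) fun hd => ?_
    · exact cellsCompute_card ((PPPair.invariant_topAnn_residue m (a d)).2 hd)
    · exact cellsCompute_one ((PPPair.invariant_topAnn_residue m (a d)).1 (not_not.1 hd))

end Decompositions

end Classes

theorem proposition5 {R : Type u} [CommRing R] [IsDomain R] [IsPruferDomain R]
    (hdense : HasDenseValueGroups R) (a : ℕ → R) (ha : IsEffectiveListing a)
    (hPP : PPStarRecursive a) :
    (∀ γ : R, γ ≠ 0 →
      HasAlgorithm InvariantsInput.Valid fun σ =>
        ∃ (N : Type u) (_ : AddCommGroup N) (_ : Module R N),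
          ClassS γ N ∧ σ.Holds a (PPPair.topAnn γ) N) ∧
    (∀ β η : R, β ≠ 0 → η ≠ 0 →
      HasAlgorithm InvariantsInput.Valid fun σ =>
        ∃ (M : Type u) (_ : AddCommGroup M) (_ : Module R M),
          ClassT β η M ∧ σ.Holds a (PPPair.annDvd η β) M) ∧
    (∀ β η : R, β ≠ 0 → η ≠ 0 →
      HasAlgorithm InvariantsInput.Valid fun σ =>
        ∃ (N : Type u) (_ : AddCommGroup N) (_ : Module R N),
          ClassS' β η N ∧ σ.Holds a (PPPair.annDvd η β) N) := by
  obtain ⟨cmp, hcmpc, hcmp⟩ := exists_isComparison ha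
  obtain ⟨mul, hmulc, hmul⟩ := ha.mul_computable
  refine ⟨fun γ hγ => ?_, fun β η _ _ => ?_, fun β η hβ hη => ?_⟩
  · obtain ⟨g, rfl⟩ := ha.surjective γ
    exact hasAlgorithm_of_isCellDecomposition (C₀ := [0]) (τ := Sum.inr g) ha hPP
      (computable_nModCells hcmpc hmulc g)
      (isCellDecomposition_nModCells hdense ha.one hcmp hmul hγ) (by simp)
      (fun m => by simp [ha.zero])
      fun m _ => (PPPair.invariant_topAnn_quotient_eq_card (mem_span_mul_map_atPrime_iff hγ m)
        (algebraMap_atPrime_ne_zero m hγ) dvd_rfl dvd_rfl).trans (card_residue_atPrime m)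
  · obtain ⟨i, rfl⟩ := ha.surjective β
    obtain ⟨j, rfl⟩ := ha.surjective η
    exact hasAlgorithm_of_isCellDecomposition (C₀ := [i, j]) (τ := Sum.inl (j, i)) ha hPP
      (computable_residueCells hcmpc) (isCellDecomposition_residueCells ha.one hcmp _) (by simp)
      (fun m => by simp) fun m hm => PPPair.invariant_annDvd_residue_eq_card hm.2 hm.1
  · obtain ⟨i, rfl⟩ := ha.surjective β
    obtain ⟨j, rfl⟩ := ha.surjective η
    exact hasAlgorithm_of_isCellDecomposition (C₀ := [i, j]) (τ := Sum.inl (j, i)) ha hPP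
      (computable_nModCells' hcmpc hmulc (mul (i, j)))
      (isCellDecomposition_nModCells' hdense ha.one hcmp hmul hβ hη (hmul (i, j))) (by simp)
      (fun m => by simp) fun m hm => PPPair.invariant_annDvd_nMod'_eq_card hβ hη hm
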